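/- Let $n\ge 2$ and let $\mathcal G$ be one of the Brown–Thompson groups $F_n$, $T_n$, $V_n$. Their elements are represented by labelled tree pairs $(\mathrm T_+,\sigma,\mathrm T_-)$: two finite rooted $n$-ary trees with the same number of leaves and a bijection $\sigma$ from the leaves of $\mathrm T_+$ to those of $\mathrm T_-$, which preserves the left-to-right order for $F_n$, preserves it up to a cyclic rotation for $T_n$, and is arbitrary for $V_n$. Identifying leaves with words in the letters $0,\dots,n-1$, the pair acts on infinite words by exchanging the prefix $u$ for $\sigma(u)$, for every leaf $u$ of $\mathrm T_+$. In a product $gh$ the factor $g$ is applied first. Let $\mathcal N(g)$ be the number of leaves of each tree in the reduced tree pair of $g$. For $0\le i\le n-2$ let $x_i\in F_n$ be given by the order-preserving pair of two-caret trees whose second caret is attached to the $i$-th leaf (counted from $0$) of the first caret in the source tree and to its last leaf in the target tree. Let $x_{n-1}\in F_n$ act as $x_0$ on the infinite words behind the first letter $n-1$, and as the identity on the infinite words with any other first letter. Let $c_0\in T_n$ be the cyclic permutation $0\mapsto 1\mapsto\dots\mapsto n-1\mapsto 0$ of the leaves of one caret, and let $\pi_0\in V_n$ exchange the first two leaves of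 the two-caret tree whose second caret is attached to the last leaf of the first. Let $X$ be the standard generating set of $\mathcal G$, that is $\{x_0,\dots,x_{n-1}\}$ for $F_n$, $\{x_0,\dots,x_{n-1},c_0\}$ for $T_n$, $\{x_0,\dots,x_{n-1},c_0,\pi_0\}$ for $V_n$, and let $|\cdot|$ be the word length with respect to $X$. Then there are constants $\delta,D>0$ and a positive integer $Q$, depending only on $n$ and $\mathcal G$, such that for every $g\in\mathcal G$ with $\mathcal N(g)\ge 3n-2$ there is a word $\omega$ in $X^{\pm1}$ of length at most $D|g|$ with $$g\,\omega \;=\; x_0^{\,Q|g|}\,x_{n-1}^{-1}\,x_0^{-Q|g|+1}\quad\text{in }\mathcal G,$$ and such that $|g\omega'|>\delta|g|$ for every prefix $\omega'$ of $\omega$; that is, the path from $g$ to $g\omega$ labelled $\omega$ in the Cayley graph $\mathrm{Cay}(\mathcal G,X)$ avoids the ball of radius $\delta|g|$ about the identity. -/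

import Mathlib

/-! ## Finite rooted `n`-ary trees

Vertices of the infinite rooted `n`-ary tree are words in the letters `0, …, n - 1`, its ends are
infinite words, i.e. streams. -/

/-- Finite rooted `n`-ary trees: a leaf, or an `n`-caret with a tree attached to each of its
`n` edges. -/
inductive NTree (n : ℕ) : Type
  | leaf : NTree n
  | caret (child : Fin n → NTree n) : NTree n

namespace NTree

variable {n : ℕ}

/-- The leaves of a tree from left to right; a leaf is recorded as the word of its branch. -/
def leaves : NTree n → List (List (Fin n))
  | leaf => [[]]
  | caret child =>
      (List.finRange n).flatMap fun i => (child i).leaves.map fun u => i :: u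

/-- The tree which consists of one `n`-caret. -/
def singleCaret (n : ℕ) : NTree n := caret fun _ => leaf

/-- One `n`-caret with the tree `t` attached to the leaf `i` (leaves numbered from `0`). -/
def hang (i : ℕ) (t : NTree n) : NTree n := caret fun j => if (j : ℕ) = i then t else leaf

/-- Attach the tree `h u` to each leaf `u`. -/
def graft : NTree n → (List (Fin n) → NTree n) → NTree n
  | leaf, h => h []
  | caret child, h => caret fun i => (child i).graft fun u => h (i :: u)

theorem leaves_graft (t : NTree n) (h : List (Fin n) → NTree n) :
    (t.graft h).leaves = t.leaves.flatMap fun u => (h u).leaves.map fun w => u ++ w := by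
  induction t generalizing h with
  | leaf => simp [graft, leaves]
  | caret child ih =>
    simp only [graft, leaves, ih, List.flatMap_assoc, List.map_flatMap, List.flatMap_map,
      List.map_map]
    rfl

theorem exists_common_graft (s t : NTree n) :
    ∃ h k : List (Fin n) → NTree n, s.graft h = t.graft k := by
  induction s generalizing t with
  | leaf => exact ⟨fun _ => t, fun _ => leaf, by
      simp only [graft]
      induction t with
      | leaf => rfl
      | caret child ih => simp only [graft]; congr 1; funext i; exact ih i⟩
  | caret child ih =>
    cases t with
    | leaf => exact ⟨fun _ => leaf, fun _ => (caret child).graft fun _ => leaf, rfl⟩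
    | caret child' =>
      choose h k hk using fun i => ih i (child' i)
      refine ⟨fun u => match u with | [] => leaf | i :: v => h i v,
        fun u => match u with | [] => leaf | i :: v => k i v, ?_⟩
      simp only [graft]
      congr 1
      funext i
      exact hk i

theorem nodup_leaves (t : NTree n) : t.leaves.Nodup := by
  induction t with
  | leaf => simp [leaves]
  | caret child ih =>
    rw [leaves, List.nodup_flatMap]
    refine ⟨fun i _ => (ih i).map fun _ _ h => (List.cons.inj h).2, ?_⟩
    refine (List.nodup_finRange n).imp ?_
    intro i j hij u hu hv
    simp only [List.mem_map] at hu hv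
    obtain ⟨a, -, rfl⟩ := hu
    obtain ⟨b, -, h⟩ := hv
    exact hij (List.cons.inj h).1.symm

/-- Cut an infinite word behind its unique prefix which is a leaf of the tree. -/
def split : NTree n → Stream' (Fin n) → List (Fin n) × Stream' (Fin n)
  | leaf, s => ([], s)
  | caret child, s =>
      (s.head :: ((child s.head).split s.tail).1, ((child s.head).split s.tail).2)

theorem split_mem (t : NTree n) (s : Stream' (Fin n)) : (t.split s).1 ∈ t.leaves := by
  induction t generalizing s with
  | leaf => simp [split, leaves]
  | caret child ih =>
    simp only [split, leaves, List.mem_flatMap, List.mem_map]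
    exact ⟨s.head, List.mem_finRange _, _, ih _ _, rfl⟩

theorem split_append (t : NTree n) (s : Stream' (Fin n)) :
    (t.split s).1 ++ₛ (t.split s).2 = s := by
  induction t generalizing s with
  | leaf => simp [split]
  | caret child ih =>
    simp only [split, Stream'.cons_append_stream, ih]
    exact Stream'.eta s

theorem split_of_mem (t : NTree n) {u : List (Fin n)} (hu : u ∈ t.leaves)
    (w : Stream' (Fin n)) : t.split (u ++ₛ w) = (u, w) := by
  induction t generalizing u with
  | leaf =>
    simp only [leaves, List.mem_singleton] at hu
    subst hu
    simp [split]
  | caret child ih =>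
    simp only [leaves, List.mem_flatMap, List.mem_map] at hu
    obtain ⟨i, -, v, hv, rfl⟩ := hu
    have h := ih i hv
    simp only [split, Stream'.cons_append_stream, Stream'.head_cons, Stream'.tail_cons, h]

end NTree

/-! ## Labelled tree pairs -/

/-- A labelled tree pair. The leaves of the source tree carry the labels `0, 1, 2, …` from left to
right; `image` lists the leaves of the target tree in the order of their labels. Thus the leaf
number `k` of `source` is sent to the entry number `k` of `image`. -/
structure TreePair (n : ℕ) where
  source : NTree n
  target : NTree n
  image : List (List (Fin n))
  perm : image.Perm target.leaves
  length_eq : source.leaves.length = image.length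

/-- The three families of groups. -/
inductive ThompsonType
  | F
  | T
  | V

/-- The labellings of the target tree allowed for each family: for `F` the labels are in the natural
order, for `T` in the natural order up to a cyclic rotation, for `V` they are arbitrary. -/
def ThompsonType.Rel (𝒢 : ThompsonType) {α : Type} (l l' : List α) : Prop :=
  match 𝒢 with
  | .F => l = l'
  | .T => l.IsRotated l'
  | .V => l.Perm l'

namespace ThompsonType

variable {𝒢 : ThompsonType} {α β : Type} {l l' l'' : List α}

theorem Rel.of_eq (h : l = l') : 𝒢.Rel l l' := by
  subst h
  cases 𝒢
  exacts [rfl, List.IsRotated.refl _, List.Perm.refl _]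

theorem Rel.symm (h : 𝒢.Rel l l') : 𝒢.Rel l' l := by
  cases 𝒢
  exacts [Eq.symm h, List.IsRotated.symm h, List.Perm.symm h]

theorem Rel.trans (h : 𝒢.Rel l l') (h' : 𝒢.Rel l' l'') : 𝒢.Rel l l'' := by
  cases 𝒢
  exacts [Eq.trans h h', List.IsRotated.trans h h', List.Perm.trans h h']

theorem Rel.perm (h : 𝒢.Rel l l') : l.Perm l' := by
  cases 𝒢
  exacts [List.Perm.of_eq h, List.IsRotated.perm h, h]

theorem Rel.flatMap (h : 𝒢.Rel l l') (f : α → List β) : 𝒢.Rel (l.flatMap f) (l'.flatMap f) := by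
  cases 𝒢
  · exact congrArg (fun m => List.flatMap f m) h
  · obtain ⟨k, rfl⟩ := List.isRotated_iff_mod.1 h |>.imp fun _ h => h.2
    show (l.flatMap f).IsRotated _
    rw [← List.rotate_mod]
    rcases Nat.eq_zero_or_pos l.length with h0 | h0
    · rw [List.length_eq_zero_iff] at h0
      subst h0
      simp
    · rw [List.rotate_eq_drop_append_take (Nat.mod_lt _ h0).le]
      conv_lhs => rw [← List.take_append_drop (k % l.length) l]
      rw [List.flatMap_append, List.flatMap_append]
      exact List.isRotated_append
  · exact List.Perm.flatMap_right f h

theorem Rel.map (h : 𝒢.Rel l l') (f : α → β) : 𝒢.Rel (l.map f) (l'.map f) := by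
  rw [List.map_eq_flatMap, List.map_eq_flatMap]
  exact h.flatMap _

end ThompsonType

namespace TreePair

variable {n : ℕ}

/-- The branches `u ↦ v` of a tree pair. -/
def branches (P : TreePair n) : List (List (Fin n) × List (Fin n)) := P.source.leaves.zip P.image

/-- The number of leaves in each of the two trees. -/
def size (P : TreePair n) : ℕ := P.source.leaves.length

/-- The tree pair is reduced: no caret whose edges all end in leaves is sent, edge by edge in
order, to such a caret. -/
def IsReduced (P : TreePair n) : Prop :=
  ¬ ∃ u v : List (Fin n), ∀ i : Fin n, (u ++ [i], v ++ [i]) ∈ P.branches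

/-- The tree pair represents the element `f`: for every branch `u ↦ v` the infinite words with
prefix `u` are sent to those with prefix `v`, by exchanging the prefix.

Elements act from the right, that is, in a product `f * g` the factor `f` is applied first;
therefore `f` lies in the opposite of the permutation group. -/
def Represents (P : TreePair n) (f : (Equiv.Perm (Stream' (Fin n)))ᵐᵒᵖ) : Prop :=
  ∀ b ∈ P.branches, ∀ w : Stream' (Fin n), f.unop (b.1 ++ₛ w) = b.2 ++ₛ w

end TreePair

/-! ## The groups -/

/-- `f` sends the cones over the words in `U` to the cones over the words in `W`, in order. -/
def Carries {n : ℕ} (f : Stream' (Fin n) → Stream' (Fin n)) (U W : List (List (Fin n))) : Prop :=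
  List.Forall₂ (fun u v => ∀ w : Stream' (Fin n), f (u ++ₛ w) = v ++ₛ w) U W

namespace Carries

variable {n : ℕ} {f g : Stream' (Fin n) → Stream' (Fin n)} {U W : List (List (Fin n))}

theorem comp {Z : List (List (Fin n))} (h : Carries f U W) (h' : Carries g W Z) :
    Carries (g ∘ f) U Z := by
  induction h generalizing Z with
  | nil => cases h'; exact List.Forall₂.nil
  | cons h1 _ ih =>
    cases h' with
    | cons h2 h3 => exact List.Forall₂.cons (fun w => by simp [h1, h2]) (ih h3)

/-- A list of images of distinct words is given by a function on words. -/
theorem exists_map (h : Carries f U W) (hU : U.Nodup) :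
    ∃ k : List (Fin n) → List (Fin n), W = U.map k := by
  induction h with
  | nil => exact ⟨id, rfl⟩
  | @cons u v U W _ _ ih =>
    obtain ⟨k, rfl⟩ := ih (List.nodup_cons.1 hU).2
    refine ⟨Function.update k u v, ?_⟩
    simp only [List.map_cons, Function.update_self, List.cons.injEq, true_and]
    refine List.map_congr_left fun a ha => ?_
    rw [Function.update_of_ne]
    rintro rfl
    exact (List.nodup_cons.1 hU).1 ha

theorem map_iff {k : List (Fin n) → List (Fin n)} :
    Carries f U (U.map k) ↔ ∀ u ∈ U, ∀ w, f (u ++ₛ w) = k u ++ₛ w := by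
  unfold Carries
  rw [List.forall₂_map_right_iff, List.forall₂_same]

theorem flatMap_map {k : List (Fin n) → List (Fin n)} (h : Carries f U (U.map k))
    (e : List (Fin n) → List (List (Fin n))) :
    Carries f (U.flatMap fun u => (e u).map fun w => u ++ w)
      (U.flatMap fun u => (e u).map fun w => k u ++ w) := by
  rw [map_iff] at h
  induction U with
  | nil => exact List.Forall₂.nil
  | cons u U ih =>
    simp only [List.flatMap_cons]
    refine List.rel_append ?_ (ih fun u hu => h u (List.mem_cons_of_mem _ hu))
    rw [List.forall₂_map_left_iff, List.forall₂_map_right_iff, List.forall₂_same]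
    intro a _ w
    rw [Stream'.append_append_stream, Stream'.append_append_stream, h u List.mem_cons_self]

end Carries

/-- The branches of a tree pair, as a statement on lists. -/
theorem TreePair.represents_iff {n : ℕ} (P : TreePair n)
    (f : (Equiv.Perm (Stream' (Fin n)))ᵐᵒᵖ) :
    P.Represents f ↔ Carries f.unop P.source.leaves P.image := by
  unfold TreePair.Represents Carries TreePair.branches
  rw [List.forall₂_iff_zip]
  refine ⟨fun h => ⟨P.length_eq, fun hab => h (_, _) hab⟩, fun h b hb => h.2 hb⟩

/-- `f` is given by the leaves of a tree `S` and of a tree `T`, labelled as `𝒢` allows it. -/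
def Given {n : ℕ} (𝒢 : ThompsonType) (f : Stream' (Fin n) → Stream' (Fin n))
    (S T : NTree n) : Prop :=
  ∃ I : List (List (Fin n)), 𝒢.Rel I T.leaves ∧ Carries f S.leaves I

theorem Given.expand_source {n : ℕ} {𝒢 : ThompsonType} {f : Stream' (Fin n) → Stream' (Fin n)}
    {S T : NTree n} (h : Given 𝒢 f S T) (e : List (Fin n) → NTree n) :
    ∃ T' : NTree n, Given 𝒢 f (S.graft e) T' := by
  obtain ⟨I, hI, hf⟩ := h
  obtain ⟨k, rfl⟩ := hf.exists_map S.nodup_leaves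
  have hnd : (S.leaves.map k).Nodup := hI.perm.nodup_iff.2 T.nodup_leaves
  have hinj := List.inj_on_of_nodup_map hnd
  classical
  obtain ⟨r, hr⟩ : ∃ r : List (Fin n) → List (Fin n), ∀ u ∈ S.leaves, r (k u) = u := by
    refine ⟨fun v => if hv : ∃ u ∈ S.leaves, k u = v then hv.choose else [], fun u hu => ?_⟩
    have hv : ∃ u' ∈ S.leaves, k u' = k u := ⟨u, hu, rfl⟩
    simp only [dif_pos hv]
    exact hinj hv.choose_spec.1 hu hv.choose_spec.2
  refine ⟨T.graft fun v => e (r v),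
    S.leaves.flatMap fun u => (e u).leaves.map fun w => k u ++ w, ?_, ?_⟩
  rotate_left 1
  · rw [NTree.leaves_graft]
    exact hf.flatMap_map fun u => (e u).leaves
  · rw [NTree.leaves_graft]
    have := hI.flatMap fun v => (e (r v)).leaves.map fun w => v ++ w
    rw [List.flatMap_map] at this
    refine (ThompsonType.Rel.of_eq ?_).trans this
    rw [List.flatMap_def, List.flatMap_def]
    refine congrArg List.flatten (List.map_congr_left fun u hu => ?_)
    rw [hr u hu]

theorem Given.symm {n : ℕ} {𝒢 : ThompsonType} {f : Equiv.Perm (Stream' (Fin n))}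
    {S T : NTree n} (h : Given 𝒢 f S T) : Given 𝒢 f.symm T S := by
  obtain ⟨I, hI, hf⟩ := h
  have hnd : I.Nodup := hI.perm.nodup_iff.2 T.nodup_leaves
  have hg : Carries f.symm I S.leaves := by
    refine List.Forall₂.flip (List.Forall₂.imp ?_ hf)
    intro u v huv w
    rw [Equiv.symm_apply_eq, huv]
  obtain ⟨k, hk⟩ := hg.exists_map hnd
  rw [hk, Carries.map_iff] at hg
  refine ⟨T.leaves.map k, ?_, ?_⟩
  · have := (hI.map k).symm
    rwa [← hk] at this
  · rw [Carries.map_iff]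
    exact fun u hu => hg u (hI.perm.mem_iff.2 hu)

theorem Given.comp {n : ℕ} {𝒢 : ThompsonType} {f g : Equiv.Perm (Stream' (Fin n))}
    {S T S' T' : NTree n} (hf : Given 𝒢 f S T) (hg : Given 𝒢 g S' T') :
    ∃ A B : NTree n, Given 𝒢 (g ∘ f) A B := by
  obtain ⟨h, k, hhk⟩ := NTree.exists_common_graft T S'
  obtain ⟨A, hA⟩ := hf.symm.expand_source h
  obtain ⟨B, hB⟩ := hg.expand_source k
  rw [← hhk] at hB
  obtain ⟨I, hI, hfI⟩ := hA.symm
  obtain ⟨J, hJ, hgJ⟩ := hB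
  obtain ⟨c, rfl⟩ := hgJ.exists_map (NTree.nodup_leaves _)
  rw [Carries.map_iff] at hgJ
  refine ⟨A, B, I.map c, (hI.map c).trans hJ, ?_⟩
  refine Carries.comp (by simpa using hfI) ?_
  rw [Carries.map_iff]
  exact fun u hu => hgJ u (hI.perm.mem_iff.1 hu)

/-- An element is represented by a tree pair with a labelling allowed for `𝒢`. -/
def IsThompson {n : ℕ} (𝒢 : ThompsonType) (f : (Equiv.Perm (Stream' (Fin n)))ᵐᵒᵖ) : Prop :=
  ∃ P : TreePair n, 𝒢.Rel P.image P.target.leaves ∧ P.Represents f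

theorem isThompson_iff {n : ℕ} (𝒢 : ThompsonType) (f : (Equiv.Perm (Stream' (Fin n)))ᵐᵒᵖ) :
    IsThompson 𝒢 f ↔ ∃ S T : NTree n, Given 𝒢 f.unop S T := by
  constructor
  · rintro ⟨P, hP, h⟩
    exact ⟨P.source, P.target, P.image, hP, (P.represents_iff f).1 h⟩
  · rintro ⟨S, T, I, hI, h⟩
    refine ⟨⟨S, T, I, hI.perm, h.length_eq⟩, hI, ?_⟩
    rw [TreePair.represents_iff]
    exact h

/-- The Brown–Thompson groups `F_n`, `T_n`, `V_n`: the elements represented by pairs of finite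
rooted `n`-ary trees with trivial, cyclic, arbitrary labellings. In a product `f * g` the factor
`f` is applied first. -/
def BrownThompson (n : ℕ) (𝒢 : ThompsonType) :
    Subgroup (Equiv.Perm (Stream' (Fin n)))ᵐᵒᵖ where
  carrier := {f | IsThompson 𝒢 f}
  one_mem' := by
    rw [Set.mem_ofPred_eq, isThompson_iff]
    exact ⟨.leaf, .leaf, [[]], .of_eq rfl, List.Forall₂.cons (fun _ => rfl) List.Forall₂.nil⟩
  mul_mem' := by
    intro f g hf hg
    rw [Set.mem_ofPred_eq, isThompson_iff] at *
    obtain ⟨S, T, hf⟩ := hf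
    obtain ⟨S', T', hg⟩ := hg
    exact hf.comp hg
  inv_mem' := by
    intro f hf
    rw [Set.mem_ofPred_eq, isThompson_iff] at *
    obtain ⟨S, T, hf⟩ := hf
    exact ⟨T, S, hf.symm⟩

/-- `𝒩(g)`: the number of leaves in each of the trees of the reduced tree pair which represents
`g` (the reduced tree pair is unique, so that the infimum is over one number). -/
noncomputable def numLeaves {n : ℕ} {𝒢 : ThompsonType} (g : BrownThompson n 𝒢) : ℕ :=
  sInf {k | ∃ P : TreePair n, P.IsReduced ∧ P.Represents g ∧ P.size = k}

/-! ## The element represented by a given tree pair -/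

namespace TreePair

variable {n : ℕ}

/-- The map on infinite words given by a tree pair. -/
def toFun (P : TreePair n) (s : Stream' (Fin n)) : Stream' (Fin n) :=
  P.image.getD (P.source.leaves.idxOf (P.source.split s).1) [] ++ₛ (P.source.split s).2

theorem toFun_apply (P : TreePair n) (k : ℕ) (hk : k < P.source.leaves.length)
    (w : Stream' (Fin n)) :
    P.toFun (P.source.leaves[k] ++ₛ w) = P.image[k]'(P.length_eq ▸ hk) ++ₛ w := by
  have h := P.source.split_of_mem (List.getElem_mem hk) w
  have hk' : k < P.image.length := P.length_eq ▸ hk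
  unfold toFun
  rw [h]
  simp only [P.source.nodup_leaves.idxOf_getElem k hk]
  rw [List.getD_eq_getElem _ _ hk']

theorem bijective_toFun (P : TreePair n) : Function.Bijective P.toFun := by
  constructor
  · intro s s' h
    obtain ⟨k, hk, hu⟩ := List.getElem_of_mem (P.source.split_mem s)
    obtain ⟨k', hk', hu'⟩ := List.getElem_of_mem (P.source.split_mem s')
    rw [← P.source.split_append s, ← P.source.split_append s', ← hu, ← hu', P.toFun_apply,
      P.toFun_apply] at h
    have h1 := P.target.split_of_mem
      (P.perm.mem_iff.1 (List.getElem_mem (P.length_eq ▸ hk))) (P.source.split s).2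
    have h2 := P.target.split_of_mem
      (P.perm.mem_iff.1 (List.getElem_mem (P.length_eq ▸ hk'))) (P.source.split s').2
    rw [h, h2, Prod.mk.injEq] at h1
    have hkk : k' = k :=
      (P.perm.nodup_iff.2 P.target.nodup_leaves).getElem_inj_iff.1 h1.1
    subst hkk
    rw [← P.source.split_append s, ← P.source.split_append s', ← hu, ← hu', h1.2]
  · intro s
    obtain ⟨k, hk, hv⟩ := List.getElem_of_mem (P.perm.mem_iff.2 (P.target.split_mem s))
    refine ⟨P.source.leaves[k]'(P.length_eq ▸ hk) ++ₛ (P.target.split s).2, ?_⟩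
    rw [P.toFun_apply k (P.length_eq ▸ hk), hv, P.target.split_append]

/-- The element represented by a tree pair. -/
noncomputable def toElement (P : TreePair n) : (Equiv.Perm (Stream' (Fin n)))ᵐᵒᵖ :=
  MulOpposite.op (Equiv.ofBijective P.toFun P.bijective_toFun)

theorem represents_toElement (P : TreePair n) : P.Represents P.toElement := by
  intro b hb w
  obtain ⟨k, hk, rfl⟩ := List.getElem_of_mem hb
  simp only [branches, List.getElem_zip]
  exact P.toFun_apply k _ w

end TreePair

/-! ## The standard generators -/

theorem NTree.length_leaves_hang {n : ℕ} (i : ℕ) (hi : i < n) (t : NTree n) :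
    (NTree.hang i t).leaves.length + 1 = n + t.leaves.length := by
  simp only [NTree.hang, NTree.leaves, List.length_flatMap, List.length_map]
  rw [← List.ofFn_eq_map, List.sum_ofFn, ← Finset.add_sum_erase _ _ (Finset.mem_univ ⟨i, hi⟩)]
  rw [Finset.sum_congr rfl (g := fun _ => 1)]
  · simp
    omega
  · intro j hj
    have : (j : ℕ) ≠ i := fun h => (Finset.mem_erase.1 hj).1 (Fin.ext h)
    simp [this, NTree.leaves]

/-- The tree pair of the generator `x_i`, `0 ≤ i ≤ n - 1`. The leaves are labelled from left to
right in both trees. For `i ≤ n - 2` both trees have two carets: in the source tree the second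
caret hangs at the leaf `i` of the first one, in the target tree at the last leaf. For `i = n - 1`
this pair for `x_0` hangs at the last leaf of one more caret. -/
def xPair (n : ℕ) (i : Fin n) : TreePair n :=
  if (i : ℕ) + 1 < n then
    { source := .hang i (.singleCaret n)
      target := .hang (n - 1) (.singleCaret n)
      image := (NTree.hang (n - 1) (.singleCaret n)).leaves
      perm := List.Perm.refl _
      length_eq := by
        have h1 := NTree.length_leaves_hang i i.isLt (.singleCaret n)
        have h2 := NTree.length_leaves_hang (n - 1) (Nat.sub_one_lt_of_lt i.isLt) (.singleCaret n)
        omega }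
  else
    { source := .hang (n - 1) (.hang 0 (.singleCaret n))
      target := .hang (n - 1) (.hang (n - 1) (.singleCaret n))
      image := (NTree.hang (n - 1) (.hang (n - 1) (.singleCaret n))).leaves
      perm := List.Perm.refl _
      length_eq := by
        have hn : 0 < n := i.pos
        have hl : n - 1 < n := Nat.sub_one_lt_of_lt hn
        have h1 := NTree.length_leaves_hang 0 hn (.singleCaret n)
        have h2 := NTree.length_leaves_hang (n - 1) hl (.singleCaret n)
        have h3 := NTree.length_leaves_hang (n - 1) hl (.hang 0 (.singleCaret n))
        have h4 := NTree.length_leaves_hang (n - 1) hl (.hang (n - 1) (.singleCaret n))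
        omega }

/-- The tree pair of the generator `c_0`: both trees are one caret, and the leaves are permuted
by the cycle `0 ↦ 1 ↦ … ↦ n - 1 ↦ 0`. -/
def cPair (n : ℕ) : TreePair n where
  source := .singleCaret n
  target := .singleCaret n
  image := (NTree.singleCaret n).leaves.rotate 1
  perm := List.rotate_perm _ 1
  length_eq := (List.length_rotate _ _).symm

/-- Exchange the first two entries of a list. -/
def swapFirstTwo {α : Type} : List α → List α
  | a :: b :: l => b :: a :: l
  | l => l

theorem swapFirstTwo_perm {α : Type} (l : List α) : (swapFirstTwo l).Perm l := by
  match l with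
  | [] => exact List.Perm.refl _
  | [_] => exact List.Perm.refl _
  | a :: b :: l => exact List.Perm.swap a b l

/-- The tree pair of the generator `π_0`: both trees consist of two carets, the second one attached
to the last leaf of the first one, and the first two leaves are exchanged. -/
def piPair (n : ℕ) : TreePair n where
  source := .hang (n - 1) (.singleCaret n)
  target := .hang (n - 1) (.singleCaret n)
  image := swapFirstTwo (NTree.hang (n - 1) (.singleCaret n)).leaves
  perm := swapFirstTwo_perm _
  length_eq := (swapFirstTwo_perm _).length_eq.symm

/-- The generator `x_i`, `0 ≤ i ≤ n - 1`, as an element of `F_n`, `T_n` or `V_n`. -/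
noncomputable def xGen (n : ℕ) (𝒢 : ThompsonType) (i : Fin n) : BrownThompson n 𝒢 :=
  ⟨(xPair n i).toElement, xPair n i, .of_eq (by unfold xPair; split_ifs <;> rfl),
    (xPair n i).represents_toElement⟩

/-- The standard generating sets: `{x_0, …, x_{n-1}}` for `F_n`, together with `c_0` for `T_n`,
and together with `c_0` and `π_0` for `V_n`. -/
def standardGenerators (n : ℕ) (𝒢 : ThompsonType) : Set (BrownThompson n 𝒢) :=
  match 𝒢 with
  | .F => Set.range (xGen n .F)
  | .T => Set.range (xGen n .T) ∪
      {⟨(cPair n).toElement, cPair n, List.IsRotated.symm ⟨1, rfl⟩,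
        (cPair n).represents_toElement⟩}
  | .V => Set.range (xGen n .V) ∪
      {⟨(cPair n).toElement, cPair n, (cPair n).perm, (cPair n).represents_toElement⟩,
        ⟨(piPair n).toElement, piPair n, (piPair n).perm, (piPair n).represents_toElement⟩}

/-! ## Words, word length, paths in the Cayley graph -/

/-- A word in the elements of `X` and their inverses. From a vertex `g` of the Cayley graph of
`(G, X)` (edges `a — a * s`, `s ∈ X`) such a word `ω` spells the edge path with the vertices
`g * ω'.prod` for the prefixes `ω'` of `ω`; it ends in `g * ω.prod`, and its length is the length
of `ω`. -/
def IsWord {G : Type*} [Group G] (X : Set G) (ω : List G) : Prop :=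
  ∀ s ∈ ω, s ∈ X ∨ s⁻¹ ∈ X

/-- The word length of `g` with respect to the generating set `X`: the length of a shortest word
which represents `g`. -/
noncomputable def wordLength {G : Type*} [Group G] (X : Set G) (g : G) : ℕ :=
  sInf {k | ∃ ω : List G, IsWord X ω ∧ ω.prod = g ∧ ω.length = k}

/-- The word length in `F_n`, `T_n`, `V_n` with respect to the standard generators. -/
noncomputable def stdLength {n : ℕ} {𝒢 : ThompsonType} (g : BrownThompson n 𝒢) : ℕ :=
  wordLength (standardGenerators n 𝒢) g

/-! Lower bounds for the word length come from one observation: a generator exchanges prefixes and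
changes their lengths by a bounded amount. Hence, for some constant `D`, an element `g` exchanges
every prefix of length at least `2 * D * |g|`, and whenever `g` exchanges `u` for `v`, the lengths
of `u` and `v` differ by at most `D * |g|` (`exists_exchangesPrefixes_stdLength`,
`length_le_of_exchange`, `length_le_of_exchange'`). In particular, from any element, the powers of a
copy of `x_0` in a cone, or those of its inverse, lead away from the identity at linear speed
(`growth`). Leaves need not be counted; the hypothesis on `numLeaves` only serves to exclude `g =
1`.

The heart is `exists_pathIn_farCopy`: an element `a` with `c * r ≤ |a| ≤ L` is joined, through
elements of length at least `r` and in O(L) steps, to an element `b` which depends on `L` only. This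
`b` is a high power of a copy of `x_0` inside the cone over a word of about `2 * D * L` zeros. That
cone is mapped by `a` into the cone over a single letter. Let `h` be a copy of `x_0` or of its
inverse in the cone over another letter. Then `a h^k a⁻¹` fixes the far cone pointwise, so it
commutes with `b`, and the path is a → a h^k → a h^k a⁻¹ → a h^k a⁻¹ b = b a h^k a⁻¹ → b a h^k → b a
→ b. The factor `h^k` keeps the first half of the path far from the identity, the factor `b` the
second half.

For the theorem, `g` is first pushed outwards by powers of `x_{n-1}` or its inverse until its length
is at least `c * |g|`. The target has length at least `c * |g|` once `Q = 2 * D * c`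
(`le_stdLength_of_eq_target`). Both are then joined to the same `b`.

All this needs `X` to generate the group, as otherwise the infimum in `wordLength` may be over an
empty set and equal 0. For `F` every tree is joined to a vine by the `x_i`; `c_0` adds the rotations
of the leaves, and `π_0` a transposition. -/

open MulOpposite


/-! ## Prefix replacement -/

section Streams

variable {n : ℕ}

/-- If one word ended earlier, a constant infinite word in a letter other than the next one of the
longer word would tell them apart; this takes two letters. -/
theorem length_eq_of_forall_append_stream (hn : 2 ≤ n) {u v : List (Fin n)}
    (h : ∀ w : Stream' (Fin n), u ++ₛ w = v ++ₛ w) : u.length = v.length := by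
  induction u generalizing v with
  | nil =>
    cases v with
    | nil => rfl
    | cons a v =>
      obtain ⟨b, hb⟩ : ∃ b : Fin n, b ≠ a := by
        have : Nontrivial (Fin n) := Fin.nontrivial_iff_two_le.2 hn
        exact exists_ne a
      have := congrArg Stream'.head (h (Stream'.const b))
      exact absurd this hb
  | cons a u ih =>
    cases v with
    | nil =>
      obtain ⟨b, hb⟩ : ∃ b : Fin n, b ≠ a := by
        have : Nontrivial (Fin n) := Fin.nontrivial_iff_two_le.2 hn
        exact exists_ne a
      have := congrArg Stream'.head (h (Stream'.const b))
      exact absurd this.symm hb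
    | cons b v =>
      have : ∀ w : Stream' (Fin n), u ++ₛ w = v ++ₛ w := fun w =>
        congrArg Stream'.tail (h w)
      simp [ih this]

namespace Carries

variable {f g : Stream' (Fin n) → Stream' (Fin n)} {U W : List (List (Fin n))}

theorem ext {T : NTree n} (hf : Carries f T.leaves W) (hg : Carries g T.leaves W) : f = g := by
  obtain ⟨k, rfl⟩ := hf.exists_map T.nodup_leaves
  rw [map_iff] at hf hg
  funext s
  rw [← T.split_append s, hf _ (T.split_mem s), hg _ (T.split_mem s)]

theorem symm {f : Equiv.Perm (Stream' (Fin n))} (h : Carries f U W) : Carries f.symm W U := by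
  refine List.Forall₂.flip (List.Forall₂.imp ?_ h)
  intro u v huv w
  rw [Equiv.symm_apply_eq, huv]

theorem exists_mem (h : Carries f U W) {u : List (Fin n)} (hu : u ∈ U) :
    ∃ v ∈ W, ∀ w, f (u ++ₛ w) = v ++ₛ w := by
  induction h with
  | nil => simp at hu
  | cons h1 _ ih =>
    rcases List.mem_cons.1 hu with rfl | hu
    · exact ⟨_, List.mem_cons_self, h1⟩
    · obtain ⟨v, hv, h⟩ := ih hu
      exact ⟨v, List.mem_cons_of_mem _ hv, h⟩

theorem caret {F : Fin n → Stream' (Fin n) → Stream' (Fin n)} {c c' : Fin n → NTree n}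
    (hf : ∀ i s, f (Stream'.cons i s) = Stream'.cons i (F i s))
    (h : ∀ i, Carries (F i) (c i).leaves (c' i).leaves) :
    Carries f (NTree.caret c).leaves (NTree.caret c').leaves := by
  unfold NTree.leaves
  induction List.finRange n with
  | nil => exact List.Forall₂.nil
  | cons i l ih =>
    simp only [List.flatMap_cons]
    refine List.rel_append ?_ ih
    rw [List.forall₂_map_left_iff, List.forall₂_map_right_iff]
    refine List.Forall₂.imp ?_ (h i)
    intro u v huv w
    rw [Stream'.cons_append_stream, Stream'.cons_append_stream, hf, huv]

theorem append_right_iff {a b : List (Fin n)} (h : Carries f (U ++ [a]) (W ++ [b])) :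
    Carries f U W ∧ ∀ w, f (a ++ₛ w) = b ++ₛ w := by
  induction U generalizing W with
  | nil =>
    cases W with
    | nil => exact ⟨.nil, by cases h; assumption⟩
    | cons c W => have := h.length_eq; simp at this
  | cons u U ih =>
    cases W with
    | nil => have := h.length_eq; simp at this
    | cons c W =>
      cases h with
      | cons h1 h2 => exact ⟨.cons h1 (ih h2).1, (ih h2).2⟩

end Carries

theorem TreePair.carries_toElement (P : TreePair n) :
    Carries P.toElement.unop P.source.leaves P.image :=
  (P.represents_iff _).1 P.represents_toElement

/-- The permutation `f` transplanted to the cone over the letter `i`. -/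
def onCone (i : Fin n) : Equiv.Perm (Stream' (Fin n)) →* Equiv.Perm (Stream' (Fin n)) where
  toFun f :=
    { toFun := fun s => if s.head = i then Stream'.cons i (f s.tail) else s
      invFun := fun s => if s.head = i then Stream'.cons i (f.symm s.tail) else s
      left_inv := fun s => by
        by_cases h : s.head = i
        · subst h; simp [Stream'.eta]
        · simp [h]
      right_inv := fun s => by
        by_cases h : s.head = i
        · subst h; simp [Stream'.eta]
        · simp [h] }
  map_one' := by
    ext1 s
    by_cases h : s.head = i
    · subst h; simp [Stream'.eta]
    · simp [h]
  map_mul' f g := by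
    ext1 s
    by_cases h : s.head = i <;> simp [h]

theorem onCone_cons (i : Fin n) (f : Equiv.Perm (Stream' (Fin n))) (s : Stream' (Fin n)) :
    onCone i f (Stream'.cons i s) = Stream'.cons i (f s) := by
  simp [onCone]

theorem onCone_of_ne {i : Fin n} (f : Equiv.Perm (Stream' (Fin n))) {s : Stream' (Fin n)}
    (h : s.head ≠ i) : onCone i f s = s := by
  simp [onCone, h]

theorem Carries.onCone {f : Equiv.Perm (Stream' (Fin n))} {S T : NTree n}
    (h : Carries f S.leaves T.leaves) (i : Fin n) :
    Carries (_root_.onCone i f) (NTree.hang i S).leaves (NTree.hang i T).leaves := by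
  refine Carries.caret (F := fun j => if j = i then f else id) ?_ ?_
  · intro j s
    by_cases hj : j = i
    · subst hj; simp [onCone_cons]
    · simp only [hj, if_false, id]
      exact onCone_of_ne _ hj
  · intro j
    by_cases hj : j = i
    · subst hj; simpa using h
    · have hj' : (j : ℕ) ≠ i := fun h => hj (Fin.ext h)
      simp only [hj, hj', if_false]
      exact .cons (fun w => rfl) .nil

end Streams

/-! ## The generators of `F` -/

section Generators

variable {m : ℕ}

theorem xPair_carries_of_lt {i : Fin (m + 1)} (hi : (i : ℕ) < m) :
    Carries (xPair (m + 1) i).toElement.unop (NTree.hang i (.singleCaret (m + 1))).leaves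
      (NTree.hang m (.singleCaret (m + 1))).leaves := by
  have h := (xPair (m + 1) i).carries_toElement
  have h1 : (i : ℕ) + 1 < m + 1 := by omega
  unfold xPair at h ⊢
  simp only [h1, if_true] at h ⊢
  exact h

theorem xPair_carries_last :
    Carries (xPair (m + 1) (Fin.last m)).toElement.unop
      (NTree.hang m (.hang 0 (.singleCaret (m + 1)))).leaves
      (NTree.hang m (.hang m (.singleCaret (m + 1)))).leaves := by
  have h := (xPair (m + 1) (Fin.last m)).carries_toElement
  unfold xPair at h ⊢
  simp at h ⊢
  exact h

theorem leaves_hang_first (t : NTree (m + 1)) :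
    (NTree.hang 0 t).leaves = t.leaves.map (fun u => 0 :: u) ++
      (List.finRange m).map fun j => [Fin.succ j] := by
  simp only [NTree.hang, NTree.leaves, List.finRange_succ, List.flatMap_cons, List.flatMap_map,
    Fin.val_zero, if_true, Fin.val_succ, Nat.succ_ne_zero, if_false]
  simp [← List.map_eq_flatMap]

theorem leaves_hang_last (t : NTree (m + 1)) :
    (NTree.hang m t).leaves = (List.finRange m).map (fun j => [Fin.castSucc j]) ++
      t.leaves.map (fun u => Fin.last m :: u) := by
  simp only [NTree.hang, NTree.leaves, List.finRange_succ_last, List.flatMap_append,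
    List.flatMap_map, Fin.val_castSucc, Fin.is_lt, Nat.ne_of_lt, if_false]
  simp [← List.map_eq_flatMap]

theorem leaves_singleCaret (n : ℕ) :
    (NTree.singleCaret n).leaves = (List.finRange n).map fun j => [j] := by
  simp [NTree.singleCaret, NTree.leaves, ← List.map_eq_flatMap]

theorem xPair_last_eq_onCone (hm : 0 < m) :
    (xPair (m + 1) (Fin.last m)).toElement =
      (onCone (Fin.last m)).op (xPair (m + 1) 0).toElement := by
  apply unop_injective
  ext1 s
  refine congrFun (Carries.ext xPair_carries_last ?_) s
  exact (xPair_carries_of_lt (i := 0) hm).onCone (Fin.last m)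

theorem xPair_fix_zero {i : Fin (m + 1)} (hi : i ≠ 0) (hm : 0 < m) (s : Stream' (Fin (m + 1))) :
    (xPair (m + 1) i).toElement.unop (Stream'.cons 0 s) = Stream'.cons 0 s := by
  obtain ⟨k, rfl⟩ := Nat.exists_eq_add_one.2 hm
  rcases (Nat.lt_succ_iff_lt_or_eq.1 i.isLt) with h | h
  · have h' := xPair_carries_of_lt h
    have hi' : ¬ 0 = (i : ℕ) := fun h => hi (Fin.ext h.symm)
    rw [NTree.hang, NTree.leaves, NTree.hang, NTree.leaves, List.finRange_succ] at h'
    simp only [List.flatMap_cons, Fin.val_zero, hi', if_false, NTree.leaves, List.map_cons,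
      List.map_nil, List.singleton_append, (Nat.succ_ne_zero k).symm] at h'
    cases h' with
    | cons h1 _ => exact h1 s
  · obtain rfl : i = Fin.last (k + 1) := Fin.ext h
    rw [xPair_last_eq_onCone hm]
    exact onCone_of_ne _ hi.symm

theorem xPair_last_cons {i : Fin (m + 1)} (hi : (i : ℕ) < m) (s : Stream' (Fin (m + 1))) :
    (xPair (m + 1) i).toElement.unop (Stream'.cons (Fin.last m) s) =
      Stream'.cons (Fin.last m) (Stream'.cons (Fin.last m) s) := by
  have h := xPair_carries_of_lt hi
  rw [leaves_hang_last, leaves_singleCaret, List.finRange_succ_last, List.map_append,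
    List.map_append, ← List.append_assoc, NTree.hang, NTree.leaves, List.finRange_succ_last,
    List.flatMap_append] at h
  have h0 : ¬ m = i := by omega
  simp only [List.flatMap_singleton, Fin.val_last, h0, if_false, NTree.leaves, List.map_cons,
    List.map_nil] at h
  exact h.append_right_iff.2 s

theorem xZero_carries (hm : 0 < m) :
    (∀ (j : Fin m) s,
      (xPair (m + 1) 0).toElement.unop (Stream'.cons 0 (Stream'.cons j.castSucc s)) =
        Stream'.cons j.castSucc s) ∧
    (∀ s, (xPair (m + 1) 0).toElement.unop (Stream'.cons 0 (Stream'.cons (Fin.last m) s)) =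
      Stream'.cons (Fin.last m) (Stream'.cons 0 s)) ∧
    ∀ (j : Fin m) s, (xPair (m + 1) 0).toElement.unop (Stream'.cons j.succ s) =
      Stream'.cons (Fin.last m) (Stream'.cons j.succ s) := by
  have h := xPair_carries_of_lt (i := (0 : Fin (m + 1))) hm
  rw [Fin.val_zero, leaves_hang_first, leaves_hang_last, leaves_singleCaret] at h
  nth_rewrite 1 [List.finRange_succ_last] at h
  rw [List.finRange_succ] at h
  simp only [List.map_append, List.map_map, List.append_assoc, List.map_cons, List.map_nil,
    List.cons_append, List.nil_append] at h
  unfold Carries at h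
  rw [List.forall₂_iff_zip] at h
  obtain ⟨-, h⟩ := h
  rw [List.zip_append (by simp), List.zip_cons_cons] at h
  simp only [List.mem_append, List.mem_cons] at h
  refine ⟨fun j s => ?_, fun s => h (Or.inr (Or.inl rfl)) s, fun j s => ?_⟩
  · refine h (a := [0, j.castSucc]) (b := [j.castSucc]) (Or.inl ?_) s
    rw [List.zip_map', List.mem_map]
    exact ⟨j, List.mem_finRange j, rfl⟩
  · refine h (a := [j.succ]) (b := [Fin.last m, j.succ]) (Or.inr (Or.inr ?_)) s
    rw [List.zip_map', List.mem_map]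
    exact ⟨j, List.mem_finRange j, rfl⟩

/-- The subgroup generated by `x_0, …, x_{n-1}`. -/
def xClosure (n : ℕ) : Subgroup (Equiv.Perm (Stream' (Fin n)))ᵐᵒᵖ :=
  Subgroup.closure (Set.range fun i => (xPair n i).toElement)

theorem xPair_mem_xClosure {n : ℕ} (i : Fin n) : (xPair n i).toElement ∈ xClosure n :=
  Subgroup.subset_closure ⟨i, rfl⟩

/-- Off the cone over `0`, `x_0` just writes the letter `n - 1` in front, and for `i ≠ 0` the
generator `x_i` lives off that cone. So conjugation by `x_0` shifts `x_i` into the last cone. -/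
theorem onCone_xPair (hm : 0 < m) {i : Fin (m + 1)} (hi : i ≠ 0) :
    (onCone (Fin.last m)).op (xPair (m + 1) i).toElement =
      (xPair (m + 1) 0).toElement⁻¹ * (xPair (m + 1) i).toElement *
        (xPair (m + 1) 0).toElement := by
  rw [mul_assoc, eq_inv_mul_iff_mul_eq]
  apply unop_injective
  ext1 s
  rw [unop_mul, unop_mul, Equiv.Perm.mul_apply, Equiv.Perm.mul_apply]
  have hlast : (0 : Fin (m + 1)) ≠ Fin.last m := fun h => hm.ne (congrArg Fin.val h)
  obtain ⟨h1, h2, h3⟩ := xZero_carries hm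
  change onCone (Fin.last m) _ _ = _
  rw [← Stream'.eta s]
  generalize s.head = a
  generalize s.tail = s
  obtain rfl | ⟨j, rfl⟩ := Fin.eq_zero_or_eq_succ a
  · rw [xPair_fix_zero hi hm, ← Stream'.eta s]
    generalize s.head = b
    generalize s.tail = s
    obtain ⟨j, rfl⟩ | rfl := b.eq_castSucc_or_eq_last
    · rw [h1, onCone_of_ne]
      exact j.castSucc_ne_last
    · rw [h2, onCone_cons, xPair_fix_zero hi hm]
  · rw [h3, onCone_cons]
    set t := (xPair (m + 1) i).toElement.unop (Stream'.cons j.succ s) with ht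
    -- `x_i` is injective and fixes the cone over `0` pointwise, so nothing else is sent into it.
    have hhead : t.head ≠ 0 := by
      intro h0
      have h4 : t = Stream'.cons 0 t.tail := by rw [← h0]; exact (Stream'.eta t).symm
      have h5 := xPair_fix_zero hi hm t.tail
      rw [← h4, ht] at h5
      have := congrArg Stream'.head ((xPair (m + 1) i).toElement.unop.injective h5)
      rw [← ht, h0] at this
      exact absurd this.symm (Fin.succ_ne_zero j)
    obtain ⟨k, hk⟩ := Fin.exists_succ_eq.2 hhead
    rw [← Stream'.eta t, ← hk, h3]

/-- The copy of `x_0` is `x_{n-1}`, the other copies are conjugates by `x_0`. This permits induction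
along the rightmost branch. -/
theorem xClosure_le_comap (hm : 0 < m) :
    xClosure (m + 1) ≤ (xClosure (m + 1)).comap (onCone (Fin.last m)).op := by
  refine (Subgroup.closure_le _).2 ?_
  rintro _ ⟨i, rfl⟩
  rw [SetLike.mem_coe, Subgroup.mem_comap]
  by_cases hi : i = 0
  · subst hi
    rw [← xPair_last_eq_onCone hm]
    exact xPair_mem_xClosure _
  · dsimp only
    rw [onCone_xPair hm hi]
    exact mul_mem (mul_mem (inv_mem (xPair_mem_xClosure _)) (xPair_mem_xClosure _))
      (xPair_mem_xClosure _)

end Generators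

/-! ## Generation of `F` -/

section GenerationF

variable {m : ℕ}

/-- Some element of the subgroup generated by the `x_i` carries the leaves of `S` to those
of `T`. -/
def XJoined (S T : NTree (m + 1)) : Prop :=
  ∃ f ∈ xClosure (m + 1), Carries f.unop S.leaves T.leaves

namespace XJoined

variable {S T U : NTree (m + 1)}

theorem refl (S : NTree (m + 1)) : XJoined S S :=
  ⟨1, one_mem _, List.forall₂_same.2 fun _ _ _ => rfl⟩

theorem symm (h : XJoined S T) : XJoined T S := by
  obtain ⟨f, hf, h⟩ := h
  exact ⟨f⁻¹, inv_mem hf, h.symm⟩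

theorem trans (h : XJoined S T) (h' : XJoined T U) : XJoined S U := by
  obtain ⟨f, hf, h⟩ := h
  obtain ⟨g, hg, h'⟩ := h'
  exact ⟨f * g, mul_mem hf hg, h.comp h'⟩

theorem hang (hm : 0 < m) (h : XJoined S T) : XJoined (NTree.hang m S) (NTree.hang m T) := by
  obtain ⟨f, hf, h⟩ := h
  exact ⟨(onCone (Fin.last m)).op f, xClosure_le_comap hm hf, h.onCone (Fin.last m)⟩

theorem length_eq (h : XJoined S T) : S.leaves.length = T.leaves.length := by
  obtain ⟨f, hf, h⟩ := h
  exact List.Forall₂.length_eq h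

end XJoined

/-! ### Leaf counts and the rightmost branch -/

namespace NTree

theorem length_leaves_caret {n : ℕ} (c : Fin n → NTree n) :
    (caret c).leaves.length = ∑ i, (c i).leaves.length := by
  simp only [leaves, List.length_flatMap, List.length_map]
  rw [← List.ofFn_eq_map, List.sum_ofFn]

theorem length_leaves_pos {n : ℕ} (hn : 0 < n) (t : NTree n) : 0 < t.leaves.length := by
  cases t with
  | leaf => simp [leaves]
  | caret c =>
    exact List.length_pos_of_mem (split_mem _ (Stream'.const ⟨0, hn⟩))

theorem length_lt_length_leaves (hm : 0 < m) (t : NTree (m + 1)) {u : List (Fin (m + 1))}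
    (hu : u ∈ t.leaves) : u.length < t.leaves.length := by
  induction t generalizing u with
  | leaf => simp_all [leaves]
  | caret c ih =>
    have hl := length_leaves_caret c
    simp only [leaves, List.mem_flatMap, List.mem_map] at hu
    obtain ⟨i, -, v, hv, rfl⟩ := hu
    have h1 := ih i hv
    obtain ⟨j, hj⟩ : ∃ j : Fin (m + 1), j ≠ i := by
      have : Nontrivial (Fin (m + 1)) := Fin.nontrivial_iff_two_le.2 (by omega)
      exact exists_ne i
    have h2 := Finset.add_le_sum (f := fun i => (c i).leaves.length) (fun _ _ => Nat.zero_le _)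
      (Finset.mem_univ i) (Finset.mem_univ j) hj.symm
    have h3 := length_leaves_pos m.succ_pos (c j)
    simp only [List.length_cons]
    omega

/-- The length of the rightmost branch. -/
def rightDepth (t : NTree (m + 1)) : ℕ := (t.split (Stream'.const (Fin.last m))).1.length

theorem rightDepth_caret (c : Fin (m + 1) → NTree (m + 1)) :
    (caret c).rightDepth = (c (Fin.last m)).rightDepth + 1 := rfl

theorem rightDepth_lt (hm : 0 < m) (t : NTree (m + 1)) : t.rightDepth < t.leaves.length :=
  t.length_lt_length_leaves hm (t.split_mem _)

theorem hang_singleCaret_graft {c : Fin (m + 1) → NTree (m + 1)} {i : Fin (m + 1)}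
    {b : Fin (m + 1) → NTree (m + 1)} (hb : c i = caret b) :
    ∃ e, (hang i (singleCaret (m + 1))).graft e = caret c := by
  refine ⟨fun u => match u with
    | [j] => c j
    | [_, k] => b k
    | _ => leaf, ?_⟩
  rw [hang, graft]
  congr 1
  funext j
  by_cases hj : j = i
  · subst hj
    simp only [if_true, singleCaret, graft, hb]
  · have hj' : (j : ℕ) ≠ i := fun h => hj (Fin.ext h)
    simp only [hj', if_false, graft]

/-- The tree with `k` carets, all of them on the rightmost branch. -/
def vine (n : ℕ) : ℕ → NTree n
  | 0 => leaf
  | k + 1 => hang (n - 1) (vine n k)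

theorem length_leaves_vine (m k : ℕ) : (vine (m + 1) k).leaves.length = 1 + k * m := by
  induction k with
  | zero => simp [vine, leaves]
  | succ k ih =>
    have := length_leaves_hang (n := m + 1) m m.lt_succ_self (vine (m + 1) k)
    rw [vine, Nat.add_sub_cancel, Nat.succ_mul]
    omega

/-- A caret at the child `i` means that the tree contains the source tree of `x_i`; applying `x_i`
doubles the first letter `n - 1` of the rightmost leaf. -/
theorem exists_xJoined_rightDepth (hm : 0 < m) {c : Fin (m + 1) → NTree (m + 1)}
    {i : Fin (m + 1)} (hi : (i : ℕ) < m) {b : Fin (m + 1) → NTree (m + 1)} (hb : c i = caret b) :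
    ∃ T, XJoined (caret c) T ∧ T.rightDepth = (caret c).rightDepth + 1 := by
  obtain ⟨e, he⟩ := hang_singleCaret_graft hb
  have h0 : Given .F (xPair (m + 1) i).toElement.unop (hang i (singleCaret (m + 1)))
      (hang m (singleCaret (m + 1))) := ⟨_, rfl, xPair_carries_of_lt hi⟩
  obtain ⟨T, I, rfl, hT⟩ := h0.expand_source e
  rw [he] at hT
  refine ⟨T, ⟨_, xPair_mem_xClosure i, hT⟩, ?_⟩
  set u := ((c (Fin.last m)).split (Stream'.const (Fin.last m))).1 with hu
  have hmem : Fin.last m :: u ∈ (caret c).leaves :=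
    (caret c).split_mem (Stream'.const (Fin.last m))
  have happ := (caret c).split_append (Stream'.const (Fin.last m))
  obtain ⟨v, hv, h⟩ := hT.exists_mem hmem
  have hlen : v.length = (Fin.last m :: Fin.last m :: u).length := by
    refine length_eq_of_forall_append_stream (by omega) fun w => ?_
    rw [← h, Stream'.cons_append_stream, xPair_last_cons hi]
    rfl
  -- The rightmost infinite word is fixed, so the image of the rightmost leaf is the rightmost leaf
  -- of `T`.
  have hconst : (xPair (m + 1) i).toElement.unop (Stream'.const (Fin.last m)) =
      Stream'.const (Fin.last m) := by
    have h1 : Stream'.const (Fin.last m) = Stream'.cons (Fin.last m) (Stream'.const (Fin.last m)) :=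
      Stream'.const_eq _
    rw [h1, xPair_last_cons hi, ← h1, ← h1]
  rw [← happ] at hconst
  change (xPair (m + 1) i).toElement.unop ((Fin.last m :: u) ++ₛ _) = _ at hconst
  rw [h, happ] at hconst
  rw [rightDepth, ← hconst, T.split_of_mem hv, hlen, rightDepth_caret]
  rfl

end NTree

open NTree in
theorem exists_xJoined_vine (hm : 0 < m) (t : NTree (m + 1)) :
    ∃ k, XJoined t (vine (m + 1) k) := by
  -- Applying `x_i` keeps the leaf count and increases the depth. Passing to the last child loses
  -- `m` leaves, but also one unit of depth; the factor 2 makes the measure drop even for `m = 1`.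
  induction hd : 2 * t.leaves.length - t.rightDepth using Nat.strong_induction_on generalizing t
    with
  | _ d ih =>
    subst hd
    cases t with
    | leaf => exact ⟨0, .refl _⟩
    | caret c =>
      by_cases h : ∀ i : Fin (m + 1), (i : ℕ) < m → c i = leaf
      · have hc : caret c = hang m (c (Fin.last m)) := by
          rw [hang]
          congr 1
          funext j
          split_ifs with hj
          · rw [Fin.ext (a := j) (b := Fin.last m) hj]
          · exact h j (by omega)
        have hlen := length_leaves_hang (n := m + 1) m m.lt_succ_self (c (Fin.last m))
        have h1 := rightDepth_caret c
        have h2 := rightDepth_lt hm (c (Fin.last m))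
        rw [← hc] at hlen
        obtain ⟨k, hk⟩ := ih _ (by omega) (c (Fin.last m)) rfl
        refine ⟨k + 1, ?_⟩
        rw [hc]
        exact hk.hang hm
      · push Not at h
        obtain ⟨i, hi, h⟩ := h
        cases hb : c i with
        | leaf => exact absurd hb h
        | caret b =>
          obtain ⟨T, hT, hd⟩ := exists_xJoined_rightDepth hm hi hb
          have h1 := hT.length_eq
          have h2 := rightDepth_lt hm T
          obtain ⟨k, hk⟩ := ih _ (by omega) T rfl
          exact ⟨k, hT.trans hk⟩

theorem xJoined_of_length_eq (hm : 0 < m) {S T : NTree (m + 1)}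
    (h : S.leaves.length = T.leaves.length) : XJoined S T := by
  obtain ⟨k, hk⟩ := exists_xJoined_vine hm S
  obtain ⟨l, hl⟩ := exists_xJoined_vine hm T
  have h1 := hk.length_eq
  have h2 := hl.length_eq
  rw [NTree.length_leaves_vine] at h1 h2
  obtain rfl : k = l := Nat.eq_of_mul_eq_mul_right hm (by omega)
  exact hk.trans hl.symm

end GenerationF

/-! ## Generation of `F`, `T` and `V` -/

namespace Carries

variable {n : ℕ} {f : Stream' (Fin n) → Stream' (Fin n)} {U W : List (List (Fin n))}

theorem rotate (h : Carries f U W) (k : ℕ) : Carries f (U.rotate k) (W.rotate k) := by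
  rw [List.rotate_eq_drop_append_take_mod, List.rotate_eq_drop_append_take_mod,
    show W.length = U.length from (List.Forall₂.length_eq h).symm]
  exact List.rel_append (List.forall₂_drop _ h) (List.forall₂_take _ h)

theorem swapFirstTwo (h : Carries f U W) :
    Carries f (_root_.swapFirstTwo U) (_root_.swapFirstTwo W) := by
  cases h with
  | nil => exact .nil
  | cons h1 h2 =>
    cases h2 with
    | nil => exact .cons h1 .nil
    | cons h2 h3 => exact .cons h2 (.cons h1 h3)

end Carries

section Generation

variable {m : ℕ} {H : Subgroup (Equiv.Perm (Stream' (Fin (m + 1))))ᵐᵒᵖ}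

theorem mem_of_given_F (hm : 0 < m) (hx : xClosure (m + 1) ≤ H)
    {f : (Equiv.Perm (Stream' (Fin (m + 1))))ᵐᵒᵖ} {S T : NTree (m + 1)}
    (h : Given .F f.unop S T) : f ∈ H := by
  obtain ⟨I, rfl, h⟩ := h
  obtain ⟨p, hp, hpc⟩ := xJoined_of_length_eq hm (List.Forall₂.length_eq h)
  have : f = p := unop_injective (DFunLike.coe_injective (h.ext hpc))
  exact this ▸ hx hp

/-! ### Rotations and permutations of the leaves -/

theorem cPair_apply :
    (∀ (j : Fin m) s, (cPair (m + 1)).toElement.unop (Stream'.cons j.castSucc s) =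
      Stream'.cons j.succ s) ∧
    ∀ s, (cPair (m + 1)).toElement.unop (Stream'.cons (Fin.last m) s) = Stream'.cons 0 s := by
  have h := (cPair (m + 1)).carries_toElement
  change Carries _ (NTree.singleCaret (m + 1)).leaves
    ((NTree.singleCaret (m + 1)).leaves.rotate 1) at h
  rw [leaves_singleCaret] at h
  nth_rewrite 1 [List.finRange_succ_last] at h
  rw [List.finRange_succ, List.map_cons, List.rotate_cons_succ, List.rotate_zero, List.map_append,
    List.map_map, List.map_map, List.map_cons, List.map_nil] at h
  obtain ⟨h1, h2⟩ := h.append_right_iff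
  refine ⟨fun j s => ?_, h2⟩
  unfold Carries at h1
  rw [List.forall₂_map_left_iff, List.forall₂_map_right_iff, List.forall₂_same] at h1
  exact h1 j (List.mem_finRange j) s

/-- The last leaf of the caret, which wraps around, carries no tree; hence the leaves rotate by a
single place. -/
theorem cPair_carries_hang (A : NTree (m + 2)) :
    Carries (cPair (m + 2)).toElement.unop (NTree.hang 0 A).leaves
      ((NTree.hang 1 A).leaves.rotate 1) := by
  obtain ⟨h1, h2⟩ := cPair_apply (m := m + 1)
  have hr : (NTree.hang 1 A).leaves = [0] :: (A.leaves.map (fun u => 1 :: u) ++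
      (List.finRange m).map fun j => [Fin.succ (Fin.succ j)]) := by
    rw [NTree.hang, NTree.leaves, List.finRange_succ, List.finRange_succ]
    simp [NTree.leaves, List.flatMap_map, ← List.map_eq_flatMap]
  rw [hr, List.rotate_cons_succ, List.rotate_zero, leaves_hang_first, List.finRange_succ_last,
    List.append_assoc, List.map_append, List.map_map]
  refine List.rel_append ?_ (List.rel_append ?_ ?_)
  · rw [List.forall₂_map_left_iff, List.forall₂_map_right_iff, List.forall₂_same]
    exact fun u _ w => h1 0 _
  · rw [List.forall₂_map_left_iff, List.forall₂_map_right_iff, List.forall₂_same]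
    exact fun j _ w => h1 j.succ _
  · exact .cons (fun w => h2 _) .nil

theorem exists_carries_rotate (hm : 0 < m) (hx : xClosure (m + 1) ≤ H)
    (hc : (cPair (m + 1)).toElement ∈ H) (T : NTree (m + 1)) (k : ℕ) :
    ∃ f ∈ H, Carries f.unop T.leaves (T.leaves.rotate k) := by
  induction k with
  | zero =>
    refine ⟨1, one_mem _, ?_⟩
    rw [List.rotate_zero]
    exact List.forall₂_same.2 fun _ _ _ => rfl
  | succ k ih =>
    obtain ⟨f, hf, hfc⟩ := ih
    suffices h : ∃ g ∈ H, Carries g.unop T.leaves (T.leaves.rotate 1) by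
      obtain ⟨g, hg, hgc⟩ := h
      refine ⟨g * f, mul_mem hg hf, ?_⟩
      have := hgc.comp (hfc.rotate 1)
      rwa [List.rotate_rotate] at this
    obtain ⟨m, rfl⟩ := Nat.exists_eq_add_one.2 hm
    obtain ⟨l, hl⟩ := exists_xJoined_vine hm T
    have hlen := hl.length_eq
    rw [NTree.length_leaves_vine] at hlen
    cases l with
    | zero =>
      refine ⟨1, one_mem _, ?_⟩
      rw [Nat.zero_mul] at hlen
      obtain ⟨a, ha⟩ := List.length_eq_one_iff.1 hlen
      rw [ha]
      rw [List.rotate_singleton]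
      exact .cons (fun _ => rfl) .nil
    | succ l =>
      -- With one caret less than the vine of `T`, so that both ways to hang `A` below a caret give
      -- as many leaves as `T` has.
      set A := NTree.vine (m + 1 + 1) l
      have h0 := NTree.length_leaves_hang (n := m + 1 + 1) 0 (by omega) A
      have h1 := NTree.length_leaves_hang (n := m + 1 + 1) 1 (by omega) A
      have hA : A.leaves.length = 1 + l * (m + 1) := NTree.length_leaves_vine _ _
      rw [Nat.succ_mul] at hlen
      obtain ⟨p, hp, hpc⟩ := xJoined_of_length_eq hm (S := T) (T := .hang 0 A) (by omega)
      obtain ⟨q, hq, hqc⟩ := xJoined_of_length_eq hm (S := .hang 1 A) (T := T) (by omega)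
      exact ⟨p * (cPair _).toElement * q, mul_mem (mul_mem (hx hp) hc) (hx hq),
        (hpc.comp (cPair_carries_hang A)).comp (hqc.rotate 1)⟩

theorem mem_of_given_T (hm : 0 < m) (hx : xClosure (m + 1) ≤ H)
    (hc : (cPair (m + 1)).toElement ∈ H)
    {f : (Equiv.Perm (Stream' (Fin (m + 1))))ᵐᵒᵖ} {S T : NTree (m + 1)}
    (h : Given .T f.unop S T) : f ∈ H := by
  obtain ⟨I, hI, h⟩ := h
  obtain ⟨k, rfl⟩ := List.IsRotated.symm hI
  have hlen := List.Forall₂.length_eq h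
  rw [List.length_rotate] at hlen
  obtain ⟨p, hp, hpc⟩ := xJoined_of_length_eq hm hlen
  obtain ⟨r, hr, hrc⟩ := exists_carries_rotate hm hx hc T k
  have : f = p * r := unop_injective (DFunLike.coe_injective (h.ext (hpc.comp hrc)))
  exact this ▸ mul_mem (hx hp) hr

/-- The last leaf of the two-caret tree is fixed by `π_0`. A vine grafted there gives a tree with as
many leaves as `T`, on which `π_0` still exchanges the first two; an element of `F` conjugates this
to `T`. -/
theorem exists_carries_swapFirstTwo (hm : 0 < m) (hx : xClosure (m + 1) ≤ H)
    (hπ : (piPair (m + 1)).toElement ∈ H) (T : NTree (m + 1))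
    (hT : 2 * m + 1 ≤ T.leaves.length) :
    ∃ f ∈ H, Carries f.unop T.leaves (swapFirstTwo T.leaves) := by
  obtain ⟨l, hl⟩ := exists_xJoined_vine hm T
  have hlen := hl.length_eq
  rw [NTree.length_leaves_vine] at hlen
  obtain ⟨l, rfl⟩ : ∃ l', l = l' + 2 :=
    Nat.exists_eq_add_of_le' (Nat.le_of_mul_le_mul_right (show 2 * m ≤ l * m by omega) hm)
  have hπc := (piPair (m + 1)).carries_toElement
  change Carries _ (NTree.hang m (.singleCaret (m + 1))).leaves
    (swapFirstTwo (NTree.hang m (.singleCaret (m + 1))).leaves) at hπc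
  obtain ⟨X, hX⟩ : ∃ X, (NTree.hang m (.singleCaret (m + 1))).leaves =
      X ++ [[Fin.last m, Fin.last m]] := by
    refine ⟨(List.finRange m).map (fun j => [Fin.castSucc j]) ++
      (List.finRange m).map fun j => [Fin.last m, Fin.castSucc j], ?_⟩
    rw [leaves_hang_last, leaves_singleCaret, List.finRange_succ_last]
    simp [Function.comp_def]
  have hXlen : X.length = 2 * m := by
    have h1 := NTree.length_leaves_hang (n := m + 1) m m.lt_succ_self (.singleCaret (m + 1))
    rw [hX, leaves_singleCaret] at h1
    simp at h1
    omega
  have hnd := (NTree.hang m (.singleCaret (m + 1))).nodup_leaves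
  set W := NTree.hang m (.singleCaret (m + 1)) with hW
  let e : List (Fin (m + 1)) → NTree (m + 1) := fun u =>
    if u = [Fin.last m, Fin.last m] then NTree.vine (m + 1) l else .leaf
  have hWe : (W.graft e).leaves =
      X ++ (NTree.vine (m + 1) l).leaves.map fun u => [Fin.last m, Fin.last m] ++ u := by
    rw [NTree.leaves_graft, hX, List.flatMap_append, List.flatMap_singleton]
    congr 1
    · conv_rhs => rw [← List.map_id X, List.map_eq_flatMap]
      rw [List.flatMap_def, List.flatMap_def]
      refine congrArg List.flatten (List.map_congr_left fun u hu => ?_)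
      have : u ≠ [Fin.last m, Fin.last m] := by
        rintro rfl
        rw [hX, List.nodup_append] at hnd
        exact hnd.2.2 _ hu _ (List.mem_singleton_self _) rfl
      simp [e, this, NTree.leaves]
    · simp [e]
  have hπe : Carries (piPair (m + 1)).toElement.unop (W.graft e).leaves
      (swapFirstTwo (W.graft e).leaves) := by
    rw [hWe]
    rw [hX] at hπc
    match X, hXlen with
    | [], h => simp at h; omega
    | [_], h => simp at h; omega
    | a :: b :: Y, _ =>
      cases hπc with
      | cons h1 h2 =>
        cases h2 with
        | cons h2 h3 =>
          refine .cons h1 (.cons h2 ?_)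
          obtain ⟨h3, h4⟩ := Carries.append_right_iff h3
          refine List.rel_append h3 ?_
          rw [List.forall₂_map_left_iff, List.forall₂_map_right_iff, List.forall₂_same]
          intro u _ w
          rw [Stream'.append_append_stream, h4]
  obtain ⟨p, hp, hpc⟩ := xJoined_of_length_eq hm (S := T) (T := W.graft e) (by
    rw [hWe, List.length_append, List.length_map, NTree.length_leaves_vine, hXlen, hlen]
    ring)
  exact ⟨p * (piPair _).toElement * p⁻¹, mul_mem (mul_mem (hx hp) hπ) (inv_mem (hx hp)),
    (hpc.comp hπe).comp hpc.symm.swapFirstTwo⟩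

/-- The permutations of the entries of `L` which are induced by elements of `H`. -/
def conePerms (H : Subgroup (Equiv.Perm (Stream' (Fin (m + 1))))ᵐᵒᵖ)
    (L : List (List (Fin (m + 1)))) : Subgroup (Equiv.Perm (Fin L.length)) where
  carrier := {σ | ∃ f ∈ H, ∀ i w, f.unop (L.get i ++ₛ w) = L.get (σ i) ++ₛ w}
  one_mem' := ⟨1, one_mem _, fun _ _ => rfl⟩
  mul_mem' := by
    rintro σ τ ⟨f, hf, hσ⟩ ⟨g, hg, hτ⟩
    -- In `σ * τ` the permutation `τ` acts first, in `g * f` the element `g`; hence the reversed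
    -- order.
    refine ⟨g * f, mul_mem hg hf, fun i w => ?_⟩
    rw [unop_mul, Equiv.Perm.mul_apply, hτ, hσ, Equiv.Perm.mul_apply]
  inv_mem' := by
    rintro σ ⟨f, hf, hσ⟩
    refine ⟨f⁻¹, inv_mem hf, fun i w => ?_⟩
    rw [unop_inv, Equiv.Perm.inv_eq_iff_eq, hσ]
    exact congrArg (fun j => L.get j ++ₛ w) (σ.apply_symm_apply i).symm

/-- A full cycle and a transposition of neighbours generate the symmetric group. -/
theorem conePerms_eq_top {L : List (List (Fin (m + 1)))} (hL : 2 ≤ L.length)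
    {r s : (Equiv.Perm (Stream' (Fin (m + 1))))ᵐᵒᵖ} (hr : r ∈ H) (hs : s ∈ H)
    (hrc : Carries r.unop L (L.rotate 1)) (hsc : Carries s.unop L (swapFirstTwo L)) :
    conePerms H L = ⊤ := by
  obtain ⟨a, b, L, rfl⟩ : ∃ a b L', L = a :: b :: L' := by
    match L, hL with
    | a :: b :: L, _ => exact ⟨a, b, L, rfl⟩
  rw [eq_top_iff]
  change (⊤ : Subgroup (Equiv.Perm (Fin (L.length + 2)))) ≤ _
  rw [← Equiv.Perm.closure_cycle_adjacent_swap (isCycle_finRotate (n := L.length))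
    support_finRotate 0, Subgroup.closure_le]
  rintro σ (rfl | rfl)
  · refine ⟨r, hr, fun i w => ?_⟩
    refine (List.Forall₂.get hrc i.isLt (by rw [List.length_rotate]; exact i.isLt) w).trans ?_
    simp only [List.get_eq_getElem, List.getElem_rotate]
    congr 2
    change Fin (L.length + 2) at i
    rw [coe_finRotate]
    split_ifs with h
    · subst h
      simp
    · have := Fin.val_lt_last h
      exact Nat.mod_eq_of_lt (by simp; omega)
  · refine ⟨s, hs, fun i w => ?_⟩
    refine (List.Forall₂.get hsc i.isLt
      (by rw [(swapFirstTwo_perm _).length_eq]; exact i.isLt) w).trans ?_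
    congr 1
    change Fin (L.length + 2) at i
    have h01 : finRotate (L.length + 2) 0 = 1 := finRotate_apply_zero
    rw [h01]
    refine Fin.cases ?_ (fun i => Fin.cases ?_ (fun i => ?_) i) i
    · rw [Equiv.swap_apply_left]; rfl
    · change _ = (a :: b :: L).get (Equiv.swap (0 : Fin (L.length + 2)) 1 1)
      rw [Equiv.swap_apply_right]; rfl
    · rw [Equiv.swap_apply_of_ne_of_ne (Fin.succ_ne_zero _)
        (b := 1)
        (fun h => Fin.succ_ne_zero i (Fin.succ_injective _ h))]
      rfl

theorem mem_of_given_V (hm : 0 < m) (hx : xClosure (m + 1) ≤ H)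
    (hc : (cPair (m + 1)).toElement ∈ H) (hπ : (piPair (m + 1)).toElement ∈ H)
    {f : (Equiv.Perm (Stream' (Fin (m + 1))))ᵐᵒᵖ} {S T : NTree (m + 1)}
    (h : Given .V f.unop S T) : f ∈ H := by
  -- Two carets below each leaf do not change the element and provide the leaves that `π_0` needs.
  obtain ⟨T, hT⟩ := h.expand_source fun _ => NTree.vine (m + 1) 2
  obtain ⟨I, hI, h⟩ := hT
  have hI : I.Perm T.leaves := hI
  have hlen : (S.graft fun _ => NTree.vine (m + 1) 2).leaves.length = T.leaves.length :=
    (List.Forall₂.length_eq h).trans hI.length_eq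
  have hT : 2 * m + 1 ≤ T.leaves.length := by
    rw [← hlen, NTree.leaves_graft]
    obtain ⟨u, hu⟩ := List.exists_mem_of_length_pos (S.length_leaves_pos m.succ_pos)
    obtain ⟨l₁, l₂, h⟩ := List.append_of_mem hu
    rw [h, List.flatMap_append, List.flatMap_cons]
    simp [NTree.length_leaves_vine]
    omega
  obtain ⟨p, hp, hpc⟩ := xJoined_of_length_eq hm hlen
  have hσ : ∀ i : Fin T.leaves.length, ∃ j : Fin T.leaves.length,
      T.leaves.get j = I.get (Fin.cast hI.length_eq.symm i) := fun i => by
    obtain ⟨j, hj, h⟩ := List.getElem_of_mem (hI.mem_iff.1 (List.get_mem I _))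
    exact ⟨⟨j, hj⟩, h⟩
  choose σ hσ using hσ
  have hinj : Function.Injective σ := fun i j hij => by
    have h1 := hσ i
    rw [hij, hσ j] at h1
    exact (Fin.cast_injective _ (List.nodup_iff_injective_get.1
      (hI.nodup_iff.2 T.nodup_leaves) h1)).symm
  obtain ⟨r, hr, hrc⟩ := exists_carries_rotate hm hx hc T 1
  obtain ⟨s, hs, hsc⟩ := exists_carries_swapFirstTwo hm hx hπ T hT
  obtain ⟨q, hq, hqσ⟩ : Equiv.ofBijective σ hinj.bijective_of_finite ∈ conePerms H T.leaves := by
    rw [conePerms_eq_top (by omega) hr hs hrc hsc]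
    exact Subgroup.mem_top _
  have hqc : Carries q.unop T.leaves I := by
    unfold Carries
    rw [List.forall₂_iff_get]
    refine ⟨hI.length_eq.symm, fun i h1 h2 w => ?_⟩
    have := hqσ ⟨i, h1⟩ w
    rw [Equiv.ofBijective_apply, hσ] at this
    exact this
  have : f = p * q := unop_injective (DFunLike.coe_injective (h.ext (hpc.comp hqc)))
  exact this ▸ mul_mem (hx hp) hq

end Generation

/-! ## Word length and paths in Cayley graphs -/

section WordLength

variable {G : Type*} [Group G] {X : Set G}

theorem IsWord.append {ω ω' : List G} (h : IsWord X ω) (h' : IsWord X ω') :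
    IsWord X (ω ++ ω') := fun s hs =>
  (List.mem_append.1 hs).elim (h s) (h' s)

theorem IsWord.map_inv_reverse {ω : List G} (h : IsWord X ω) :
    IsWord X (ω.map (·⁻¹)).reverse := fun s hs => by
  rw [List.mem_reverse, List.mem_map] at hs
  obtain ⟨t, ht, rfl⟩ := hs
  rw [inv_inv]
  exact (h t ht).symm

theorem wordLength_le {ω : List G} (h : IsWord X ω) : wordLength X ω.prod ≤ ω.length :=
  Nat.sInf_le ⟨ω, h, rfl, rfl⟩

theorem wordLength_one : wordLength X (1 : G) = 0 :=
  Nat.le_zero.1 (wordLength_le (X := X) (ω := []) fun _ h => by simp at h)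

theorem wordLength_le_one {s : G} (h : s ∈ X ∨ s⁻¹ ∈ X) : wordLength X s ≤ 1 := by
  have := wordLength_le (X := X) (ω := [s]) fun t ht => by
    rw [List.mem_singleton.1 ht]; exact h
  simpa using this

theorem exists_word (hX : Subgroup.closure X = ⊤) (g : G) :
    ∃ ω : List G, IsWord X ω ∧ ω.prod = g ∧ ω.length = wordLength X g := by
  have : {k | ∃ ω : List G, IsWord X ω ∧ ω.prod = g ∧ ω.length = k}.Nonempty := by
    suffices h : ∃ ω : List G, IsWord X ω ∧ ω.prod = g by
      obtain ⟨ω, h, hg⟩ := h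
      exact ⟨_, ω, h, hg, rfl⟩
    have hg : g ∈ Subgroup.closure X := hX ▸ Subgroup.mem_top g
    induction hg using Subgroup.closure_induction with
    | mem s hs => exact ⟨[s], fun t ht => Or.inl (List.mem_singleton.1 ht ▸ hs), by simp⟩
    | one => exact ⟨[], fun _ h => by simp at h, rfl⟩
    | mul _ _ _ _ h h' =>
      obtain ⟨ω, hω, rfl⟩ := h
      obtain ⟨ω', hω', rfl⟩ := h'
      exact ⟨ω ++ ω', hω.append hω', List.prod_append⟩
    | inv _ _ h =>
      obtain ⟨ω, hω, rfl⟩ := h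
      exact ⟨_, hω.map_inv_reverse, (List.prod_inv_reverse ω).symm⟩
  exact Nat.sInf_mem this

theorem wordLength_mul_le (hX : Subgroup.closure X = ⊤) (g h : G) :
    wordLength X (g * h) ≤ wordLength X g + wordLength X h := by
  obtain ⟨ω, hω, rfl, h1⟩ := exists_word hX g
  obtain ⟨ω', hω', rfl, h2⟩ := exists_word hX h
  rw [← h1, ← h2, ← List.prod_append, ← List.length_append]
  exact wordLength_le (hω.append hω')

theorem wordLength_inv_le (hX : Subgroup.closure X = ⊤) (g : G) :
    wordLength X g⁻¹ ≤ wordLength X g := by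
  obtain ⟨ω, hω, rfl, h1⟩ := exists_word hX g
  rw [← h1, List.prod_inv_reverse]
  exact (wordLength_le hω.map_inv_reverse).trans_eq (by simp)

theorem wordLength_inv (hX : Subgroup.closure X = ⊤) (g : G) :
    wordLength X g⁻¹ = wordLength X g :=
  le_antisymm (wordLength_inv_le hX g)
    ((congrArg (wordLength X) (inv_inv g)).symm.le.trans (wordLength_inv_le hX g⁻¹))

theorem wordLength_le_mul_add (hX : Subgroup.closure X = ⊤) (g h : G) :
    wordLength X g ≤ wordLength X (g * h) + wordLength X h := by
  have := wordLength_mul_le hX (g * h) h⁻¹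
  rwa [mul_inv_cancel_right, wordLength_inv hX] at this

theorem wordLength_pow_le (hX : Subgroup.closure X = ⊤) (g : G) (k : ℕ) :
    wordLength X (g ^ k) ≤ k * wordLength X g := by
  induction k with
  | zero => simp [wordLength_one]
  | succ k ih =>
    rw [pow_succ, Nat.succ_mul]
    exact (wordLength_mul_le hX _ _).trans (Nat.add_le_add_right ih _)

theorem eq_one_of_wordLength_eq_zero (hX : Subgroup.closure X = ⊤) {g : G}
    (h : wordLength X g = 0) : g = 1 := by
  obtain ⟨ω, -, rfl, h1⟩ := exists_word hX g
  rw [List.length_eq_zero_iff.1 (h1.trans h), List.prod_nil]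

/-- A path of length at most `k` from `a` to `b` in the Cayley graph, with all vertices in `S`. -/
def PathIn (X S : Set G) (k : ℕ) (a b : G) : Prop :=
  ∃ ω : List G, IsWord X ω ∧ ω.length ≤ k ∧ a * ω.prod = b ∧ ∀ ω', ω' <+: ω → a * ω'.prod ∈ S

namespace PathIn

variable {S S' : Set G} {k l : ℕ} {a b c : G}

theorem mono (h : PathIn X S k a b) (hS : S ⊆ S') (hk : k ≤ l) : PathIn X S' l a b := by
  obtain ⟨ω, h1, h2, h3, h4⟩ := h
  exact ⟨ω, h1, h2.trans hk, h3, fun ω' h => hS (h4 ω' h)⟩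

theorem trans (h : PathIn X S k a b) (h' : PathIn X S l b c) : PathIn X S (k + l) a c := by
  obtain ⟨ω, h1, h2, rfl, h4⟩ := h
  obtain ⟨ω₂, h1', h2', h3', h4'⟩ := h'
  refine ⟨ω ++ ω₂, h1.append h1', by rw [List.length_append]; omega,
    by rw [List.prod_append, ← mul_assoc, h3'], fun ω' h => ?_⟩
  rcases List.prefix_or_prefix_of_prefix h (List.prefix_append ω ω₂) with h | h5
  · exact h4 _ h
  · obtain ⟨t, rfl⟩ := h5
    rw [List.prefix_append_right_inj] at h
    rw [List.prod_append, ← mul_assoc]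
    exact h4' _ h

theorem symm (h : PathIn X S k a b) : PathIn X S k b a := by
  obtain ⟨ω, h1, h2, rfl, h4⟩ := h
  refine ⟨_, h1.map_inv_reverse, by simpa using h2, ?_, fun ω' h => ?_⟩
  · rw [← List.prod_inv_reverse, mul_inv_cancel_right]
  · rw [← List.reverse_suffix, List.reverse_reverse, List.suffix_map_iff] at h
    obtain ⟨t, ⟨p, rfl⟩, ht⟩ := h
    rw [List.reverse_eq_iff] at ht
    rw [ht, ← List.prod_inv_reverse, List.prod_append, mul_assoc, mul_inv_cancel_right]
    exact h4 _ (List.prefix_append _ _)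

/-- Along a shortest word for `w` no vertex is farther than `|w|` from `a`. -/
theorem of_add_le (hX : Subgroup.closure X = ⊤) {r : ℕ} (a w : G)
    (h : r + wordLength X w ≤ wordLength X a) :
    PathIn X {x | r ≤ wordLength X x} (wordLength X w) a (a * w) := by
  obtain ⟨ω, h1, rfl, h3⟩ := exists_word hX w
  refine ⟨ω, h1, h3.le, rfl, fun ω' hω' => ?_⟩
  have h4 := wordLength_le (X := X) fun s hs => h1 s (hω'.subset hs)
  have h5 := hω'.length_le
  have h6 := wordLength_le_mul_add hX a ω'.prod
  rw [Set.mem_ofPred_eq]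
  omega

theorem step {s : G} (hs : s ∈ X ∨ s⁻¹ ∈ X) (ha : a ∈ S) (hb : a * s ∈ S) :
    PathIn X S 1 a (a * s) := by
  refine ⟨[s], fun t ht => by rw [List.mem_singleton.1 ht]; exact hs, le_rfl, by simp,
    fun ω' h => ?_⟩
  rcases List.prefix_cons_iff.1 h with rfl | ⟨t, rfl, ht⟩
  · simpa using ha
  · rw [List.prefix_nil.1 ht]
    simpa using hb

theorem pow {s : G} (ha : a ∈ S) (n : ℕ)
    (h : ∀ j < n, PathIn X S k (a * s ^ j) (a * s ^ j * s)) :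
    PathIn X S (n * k) a (a * s ^ n) := by
  induction n with
  | zero =>
    refine ⟨[], fun _ h => by simp at h, by simp, by simp, fun ω' h => ?_⟩
    rw [List.prefix_nil.1 h]
    simpa using ha
  | succ n ih =>
    rw [Nat.succ_mul, pow_succ, ← mul_assoc]
    exact (ih fun j hj => h j (by omega)).trans (h n n.lt_succ_self)

end PathIn

end WordLength

/-! ## The action on infinite words -/

section Action

variable {n : ℕ} {𝒢 : ThompsonType}

theorem closure_standardGenerators (hn : 2 ≤ n) (𝒢 : ThompsonType) :
    Subgroup.closure (standardGenerators n 𝒢) = ⊤ := by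
  obtain ⟨m, rfl⟩ : ∃ m, n = m + 1 := ⟨n - 1, by omega⟩
  have hm : 0 < m := by omega
  rw [eq_top_iff]
  intro g _
  set H := (Subgroup.closure (standardGenerators (m + 1) 𝒢)).map
    (BrownThompson (m + 1) 𝒢).subtype with hH
  have hgen : ∀ s ∈ standardGenerators (m + 1) 𝒢, (s : (Equiv.Perm _)ᵐᵒᵖ) ∈ H := fun s hs =>
    ⟨s, Subgroup.subset_closure hs, rfl⟩
  have hx : xClosure (m + 1) ≤ H := by
    refine (Subgroup.closure_le _).2 ?_
    rintro _ ⟨i, rfl⟩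
    refine hgen (xGen (m + 1) 𝒢 i) ?_
    cases 𝒢
    · exact ⟨i, rfl⟩
    · exact Or.inl ⟨i, rfl⟩
    · exact Or.inl ⟨i, rfl⟩
  have hg : (g : (Equiv.Perm (Stream' (Fin (m + 1))))ᵐᵒᵖ) ∈ H := by
    obtain ⟨S, T, hST⟩ := (isThompson_iff 𝒢 _).1 g.2
    cases 𝒢 with
    | F => exact mem_of_given_F hm hx hST
    | T => exact mem_of_given_T hm hx (hgen _ (Or.inr rfl)) hST
    | V => exact mem_of_given_V hm hx (hgen _ (Or.inr (Or.inl rfl)))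
            (hgen _ (Or.inr (Or.inr rfl))) hST
  obtain ⟨g', hg', h⟩ := hg
  exact (Subtype.ext h : g' = g) ▸ hg'

theorem finite_standardGenerators (n : ℕ) (𝒢 : ThompsonType) :
    (standardGenerators n 𝒢).Finite := by
  cases 𝒢
  · exact Set.finite_range _
  · exact (Set.finite_range _).union (Set.finite_singleton _)
  · exact (Set.finite_range _).union (Set.toFinite _)

/-- The permutation of the infinite words given by an element of the group. -/
def act (g : BrownThompson n 𝒢) : Equiv.Perm (Stream' (Fin n)) := (g : (Equiv.Perm _)ᵐᵒᵖ).unop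

theorem act_injective : Function.Injective (act (n := n) (𝒢 := 𝒢)) := fun _ _ h =>
  Subtype.ext (unop_injective h)

theorem act_mul (g h : BrownThompson n 𝒢) (s : Stream' (Fin n)) :
    act (g * h) s = act h (act g s) := rfl

theorem act_inv_eq_iff (g : BrownThompson n 𝒢) {s t : Stream' (Fin n)} :
    act g⁻¹ s = t ↔ s = act g t := Equiv.symm_apply_eq (act g)

/-- On the cones over words of length at least `D` the map `f` exchanges prefixes, and it shortens
them by at most `e`. -/
def ExchangesPrefixes (f : Stream' (Fin n) → Stream' (Fin n)) (D e : ℕ) : Prop :=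
  ∀ u : List (Fin n), D ≤ u.length →
    ∃ v : List (Fin n), u.length ≤ v.length + e ∧ ∀ w, f (u ++ₛ w) = v ++ₛ w

theorem NTree.exists_leaf_prefix (t : NTree n) :
    ∃ D, ∀ u : List (Fin n), D ≤ u.length → ∃ p ∈ t.leaves, ∃ q, u = p ++ q ∧ p.length ≤ D := by
  induction t with
  | leaf => exact ⟨0, fun u _ => ⟨[], by simp [leaves], u, rfl, le_rfl⟩⟩
  | caret c ih =>
    choose D hD using ih
    refine ⟨∑ i, D i + 1, fun u hu => ?_⟩
    cases u with
    | nil => simp at hu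
    | cons i u =>
      have h1 : D i ≤ ∑ i, D i := Finset.single_le_sum (fun _ _ => Nat.zero_le _)
        (Finset.mem_univ i)
      rw [List.length_cons] at hu
      obtain ⟨p, hp, q, rfl, h⟩ := hD i u (by omega)
      refine ⟨i :: p, ?_, q, rfl, by rw [List.length_cons]; omega⟩
      simp only [leaves, List.mem_flatMap, List.mem_map]
      exact ⟨i, List.mem_finRange i, p, hp, rfl⟩

theorem exists_exchangesPrefixes (g : BrownThompson n 𝒢) :
    ∃ D, ExchangesPrefixes (act g) D D := by
  obtain ⟨S, T, I, -, h⟩ := (isThompson_iff 𝒢 _).1 g.2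
  obtain ⟨D, hD⟩ := S.exists_leaf_prefix
  refine ⟨D, fun u hu => ?_⟩
  obtain ⟨p, hp, q, rfl, hpD⟩ := hD u hu
  obtain ⟨v, -, hv⟩ := h.exists_mem hp
  refine ⟨v ++ q, by simp only [List.length_append]; omega, fun w => ?_⟩
  rw [Stream'.append_append_stream, Stream'.append_append_stream]
  exact hv _

theorem ExchangesPrefixes.mono {f : Stream' (Fin n) → Stream' (Fin n)} {D D' e e' : ℕ}
    (h : ExchangesPrefixes f D e) (hD : D ≤ D') (he : e ≤ e') : ExchangesPrefixes f D' e' :=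
  fun u hu => (h u (hD.trans hu)).imp fun _ hv => ⟨hv.1.trans (by omega), hv.2⟩

/-- Each letter of a word for `g` shortens a prefix by at most `D`. A threshold of `2 * D` per
letter thus leaves enough length for the remaining letters. -/
theorem exists_exchangesPrefixes_stdLength (hn : 2 ≤ n) (𝒢 : ThompsonType) :
    ∃ D, 0 < D ∧ ∀ g : BrownThompson n 𝒢,
      ExchangesPrefixes (act g) (2 * D * stdLength g) (D * stdLength g) := by
  choose d hd using exists_exchangesPrefixes (n := n) (𝒢 := 𝒢)
  obtain ⟨D, hD⟩ := ((finite_standardGenerators n 𝒢).image fun s => d s + d s⁻¹).bddAbove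
  refine ⟨D + 1, D.succ_pos, fun g => ?_⟩
  have hgen : ∀ s, s ∈ standardGenerators n 𝒢 ∨ s⁻¹ ∈ standardGenerators n 𝒢 →
      ExchangesPrefixes (act s) (D + 1) (D + 1) := by
    intro s hs
    have : d s ≤ D + 1 := by
      rcases hs with hs | hs
      · have := hD (Set.mem_image_of_mem _ hs)
        omega
      · have := hD (Set.mem_image_of_mem _ hs)
        simp only [inv_inv] at this
        omega
    exact (hd s).mono this this
  obtain ⟨ω, hω, rfl, hl⟩ := exists_word (closure_standardGenerators hn 𝒢) g
  rw [stdLength, ← hl]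
  clear hl
  induction ω with
  | nil => exact fun u _ => ⟨u, by simp, fun w => rfl⟩
  | cons s ω ih =>
    intro u hu
    rw [List.length_cons, Nat.mul_succ] at hu
    obtain ⟨v, hv, h⟩ := hgen s (hω s List.mem_cons_self) u (by omega)
    obtain ⟨v', hv', h'⟩ := ih (fun t ht => hω t (List.mem_cons_of_mem _ ht)) v (by omega)
    refine ⟨v', by rw [List.length_cons, Nat.mul_succ]; omega, fun w => ?_⟩
    rw [List.prod_cons, act_mul, h, h']

/-- Appending the same zeros to `u` and `v` reaches the threshold without altering the difference of
lengths. -/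
theorem length_le_of_exchange (hn : 2 ≤ n) {D : ℕ}
    (hD : ∀ g : BrownThompson n 𝒢,
      ExchangesPrefixes (act g) (2 * D * stdLength g) (D * stdLength g))
    {g : BrownThompson n 𝒢} {u v : List (Fin n)} (h : ∀ w, act g (u ++ₛ w) = v ++ₛ w) :
    u.length ≤ v.length + D * stdLength g := by
  set t := List.replicate (2 * D * stdLength g) (⟨0, by omega⟩ : Fin n) with ht
  obtain ⟨v', h1, h2⟩ := hD g (u ++ t) (by simp [ht])
  have h3 : v'.length = (v ++ t).length := length_eq_of_forall_append_stream hn fun w => by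
    rw [← h2, Stream'.append_append_stream, h, Stream'.append_append_stream]
  simp only [List.length_append] at h1 h3
  omega

theorem length_le_of_exchange' (hn : 2 ≤ n) {D : ℕ}
    (hD : ∀ g : BrownThompson n 𝒢,
      ExchangesPrefixes (act g) (2 * D * stdLength g) (D * stdLength g))
    {g : BrownThompson n 𝒢} {u v : List (Fin n)} (h : ∀ w, act g (u ++ₛ w) = v ++ₛ w) :
    v.length ≤ u.length + D * stdLength g := by
  have := length_le_of_exchange hn hD (g := g⁻¹) (u := v) (v := u) fun w =>
    (act_inv_eq_iff g).2 (h w).symm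
  rwa [stdLength, wordLength_inv (closure_standardGenerators hn 𝒢)] at this

end Action

/-! ## Paths to a standard element -/

section Path

variable {m : ℕ} {𝒢 : ThompsonType}

theorem act_xGen_zero (hm : 0 < m) :
    (∀ s, act (xGen (m + 1) 𝒢 0) (Stream'.cons 0 (Stream'.cons 0 s)) = Stream'.cons 0 s) ∧
    (∀ s, act (xGen (m + 1) 𝒢 0) (Stream'.cons 0 (Stream'.cons (Fin.last m) s)) =
      Stream'.cons (Fin.last m) (Stream'.cons 0 s)) ∧
    ∀ s, act (xGen (m + 1) 𝒢 0) (Stream'.cons (Fin.last m) s) =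
      Stream'.cons (Fin.last m) (Stream'.cons (Fin.last m) s) := by
  obtain ⟨k, rfl⟩ := Nat.exists_eq_add_one.2 hm
  obtain ⟨h1, h2, h3⟩ := xZero_carries hm
  exact ⟨h1 0, h2, h3 (Fin.last k)⟩

theorem act_xGen_last (hm : 0 < m) :
    act (xGen (m + 1) 𝒢 (Fin.last m)) = onCone (Fin.last m) (act (xGen (m + 1) 𝒢 0)) :=
  op_injective (xPair_last_eq_onCone hm)

theorem exists_act_eq_onCone (hm : 0 < m) (𝒢 : ThompsonType) (i : Fin (m + 1)) :
    ∃ y : BrownThompson (m + 1) 𝒢, act y = onCone i (act (xGen (m + 1) 𝒢 0)) := by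
  refine ⟨⟨op (onCone i (act (xGen (m + 1) 𝒢 0))), (isThompson_iff 𝒢 _).2 ⟨_, _, _, .of_eq rfl,
    Carries.onCone (xPair_carries_of_lt (i := 0) hm) i⟩⟩, rfl⟩

theorem pow_apply_replicate {n : ℕ} {f : Equiv.Perm (Stream' (Fin n))} {a : Fin n}
    {p : List (Fin n)}
    (hf : ∀ s, f (p ++ₛ Stream'.cons a (Stream'.cons a s)) = p ++ₛ Stream'.cons a s) (k : ℕ)
    (s : Stream' (Fin n)) :
    (f ^ k) (p ++ₛ (List.replicate (k + 1) a ++ₛ s)) = p ++ₛ Stream'.cons a s := by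
  induction k with
  | zero => rfl
  | succ k ih =>
    rw [pow_succ, Equiv.Perm.mul_apply]
    refine Eq.trans (congrArg _ ?_) ih
    exact hf _

theorem act_xGen_zero_pow (hm : 0 < m) (k : ℕ) (s : Stream' (Fin (m + 1))) :
    act (xGen (m + 1) 𝒢 0 ^ k) (List.replicate (k + 1) 0 ++ₛ s) = Stream'.cons 0 s :=
  pow_apply_replicate (p := []) (act_xGen_zero hm).1 k s

theorem onCone_pow_apply_replicate (hm : 0 < m) {i : Fin (m + 1)} {y : BrownThompson (m + 1) 𝒢}
    (hy : act y = onCone i (act (xGen (m + 1) 𝒢 0))) (k : ℕ) (s : Stream' (Fin (m + 1))) :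
    act (y ^ k) (Stream'.cons i (List.replicate (k + 1) 0 ++ₛ s)) =
      Stream'.cons i (Stream'.cons 0 s) := by
  refine pow_apply_replicate (p := [i]) (fun s => ?_) k s
  change act y (Stream'.cons i (Stream'.cons 0 (Stream'.cons 0 s))) = _
  rw [hy, onCone_cons, (act_xGen_zero hm).1]
  rfl

theorem act_pow_of_head_ne {i : Fin (m + 1)} {y : BrownThompson (m + 1) 𝒢}
    (hy : ∀ s : Stream' (Fin (m + 1)), s.head ≠ i → act y s = s) (k : ℕ)
    {s : Stream' (Fin (m + 1))} (h : s.head ≠ i) : act (y ^ k) s = s := by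
  induction k with
  | zero => rfl
  | succ k ih => rw [pow_succ, act_mul, ih, hy s h]

theorem replicate_add_append {n : ℕ} (a : Fin n) (k l : ℕ) (s : Stream' (Fin n)) :
    List.replicate (k + l) a ++ₛ s = List.replicate k a ++ₛ (List.replicate l a ++ₛ s) := by
  rw [List.replicate_add, Stream'.append_append_stream]

/-- Powers of a copy of `x_0` or of its inverse drive every element away from the identity. -/
theorem growth (hm : 0 < m) {D : ℕ}
    (hD : ∀ g : BrownThompson (m + 1) 𝒢,
      ExchangesPrefixes (act g) (2 * D * stdLength g) (D * stdLength g))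
    {i : Fin (m + 1)} {y : BrownThompson (m + 1) 𝒢}
    (hy : act y = onCone i (act (xGen (m + 1) 𝒢 0))) (a : BrownThompson (m + 1) 𝒢) :
    (∀ j, j ≤ D * stdLength (a * y ^ j)) ∨ ∀ j, j ≤ D * stdLength (a * y⁻¹ ^ j) := by
  set M := 2 * D * stdLength a⁻¹ with hM
  obtain ⟨V, -, hV⟩ := hD a⁻¹ (i :: List.replicate (M + 1) 0) (by simp; omega)
  have hV' : ∀ w, act a (V ++ₛ w) = Stream'.cons i (List.replicate (M + 1) 0 ++ₛ w) := fun w =>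
    ((act_inv_eq_iff a).1 (hV w)).symm
  have key : ∀ j w, act (y ^ j) (Stream'.cons i (List.replicate (M + 1) 0 ++ₛ
      (List.replicate j 0 ++ₛ w))) = Stream'.cons i (List.replicate (M + 1) 0 ++ₛ w) := by
    intro j w
    rw [← replicate_add_append, show M + 1 + j = (j + 1) + M by omega, replicate_add_append,
      onCone_pow_apply_replicate hm hy]
    rfl
  -- Positive powers of `y` delete zeros behind `i`, negative ones insert them. The sign is chosen
  -- so that this adds to the discrepancy between `V` and its image under `a`, of length `M + 2`,
  -- instead of cancelling it.
  rcases le_total (M + 2) V.length with h | h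
  · refine Or.inl fun j => ?_
    have := length_le_of_exchange (by omega) hD (g := a * y ^ j) (u := V ++ List.replicate j 0)
      (v := i :: List.replicate (M + 1) 0) fun w => by
        rw [act_mul, Stream'.append_append_stream, hV', key]
        rfl
    simp only [List.length_append, List.length_cons, List.length_replicate] at this
    omega
  · refine Or.inr fun j => ?_
    have := length_le_of_exchange' (by omega) hD (g := a * y⁻¹ ^ j) (u := V)
      (v := i :: (List.replicate (M + 1) 0 ++ List.replicate j 0)) fun w => by
        rw [act_mul, hV', inv_pow, act_inv_eq_iff, Stream'.cons_append_stream,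
          Stream'.append_append_stream, key]
    simp only [List.length_append, List.length_cons, List.length_replicate] at this
    omega

/-- The copy of `y ^ k` in a cone far to the left, for `y` supported in the leftmost cone. -/
noncomputable def farCopy (y : BrownThompson (m + 1) 𝒢) (M k : ℕ) : BrownThompson (m + 1) 𝒢 :=
  xGen (m + 1) 𝒢 0 ^ M * y ^ k * (xGen (m + 1) 𝒢 0 ^ M)⁻¹

theorem act_farCopy_of_notMem (hm : 0 < m) {y : BrownThompson (m + 1) 𝒢}
    (hy : act y = onCone 0 (act (xGen (m + 1) 𝒢 0))) (M k : ℕ) {s : Stream' (Fin (m + 1))}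
    (hs : ∀ w, s ≠ List.replicate (M + 1) 0 ++ₛ w) : act (farCopy y M k) s = s := by
  rw [farCopy, act_mul, act_mul, act_inv_eq_iff]
  refine act_pow_of_head_ne (i := 0) (fun s h => by rw [hy]; exact onCone_of_ne _ h) k ?_
  intro h0
  refine hs (act (xGen (m + 1) 𝒢 0 ^ M) s).tail ((act (xGen (m + 1) 𝒢 0 ^ M)).injective ?_)
  rw [act_xGen_zero_pow hm]
  exact (Stream'.eta _).symm.trans (by rw [h0])

theorem act_farCopy (hm : 0 < m) {y : BrownThompson (m + 1) 𝒢}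
    (hy : act y = onCone 0 (act (xGen (m + 1) 𝒢 0))) (M k : ℕ) (s : Stream' (Fin (m + 1))) :
    act (farCopy y M k) (List.replicate (M + 1 + (k + 1)) 0 ++ₛ s) =
      List.replicate (M + 2) 0 ++ₛ s := by
  rw [farCopy, act_mul, act_mul, act_inv_eq_iff, replicate_add_append, act_xGen_zero_pow hm,
    onCone_pow_apply_replicate hm hy, replicate_add_append 0 (M + 1) 1, act_xGen_zero_pow hm]
  rfl

theorem stdLength_farCopy_le (hm : 0 < m) (y : BrownThompson (m + 1) 𝒢) (M k : ℕ) :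
    stdLength (farCopy y M k) ≤
      M * stdLength (xGen (m + 1) 𝒢 0) + k * stdLength y + M * stdLength (xGen (m + 1) 𝒢 0) := by
  have hX := closure_standardGenerators (n := m + 1) (by omega) 𝒢
  have h1 := wordLength_pow_le hX (xGen (m + 1) 𝒢 0) M
  have h2 := wordLength_pow_le hX y k
  have h3 := wordLength_mul_le hX (xGen (m + 1) 𝒢 0 ^ M * y ^ k) (xGen (m + 1) 𝒢 0 ^ M)⁻¹
  have h4 := wordLength_mul_le hX (xGen (m + 1) 𝒢 0 ^ M) (y ^ k)
  rw [wordLength_inv hX] at h3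
  unfold stdLength farCopy
  omega

/-- The far copy deletes `k` zeros inside a cone on which `c` is trivial, so `c` cannot compensate
for it. -/
theorem le_stdLength_farCopy_mul (hm : 0 < m) {D : ℕ}
    (hD : ∀ g : BrownThompson (m + 1) 𝒢,
      ExchangesPrefixes (act g) (2 * D * stdLength g) (D * stdLength g))
    {y : BrownThompson (m + 1) 𝒢} (hy : act y = onCone 0 (act (xGen (m + 1) 𝒢 0))) (M k : ℕ)
    {c : BrownThompson (m + 1) 𝒢}
    (hc : ∀ w, act c (List.replicate (M + 1) 0 ++ₛ w) = List.replicate (M + 1) 0 ++ₛ w) :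
    k ≤ D * stdLength (farCopy y M k * c) := by
  have := length_le_of_exchange (by omega) hD (g := farCopy y M k * c)
    (u := List.replicate (M + 1 + (k + 1)) 0) (v := List.replicate (M + 2) 0) fun w => by
      rw [act_mul, act_farCopy hm hy, replicate_add_append 0 (M + 1) 1, hc]
  simp only [List.length_replicate] at this
  omega

theorem farCopy_mul_comm (hm : 0 < m) {y : BrownThompson (m + 1) 𝒢}
    (hy : act y = onCone 0 (act (xGen (m + 1) 𝒢 0))) (M k : ℕ) {c : BrownThompson (m + 1) 𝒢}
    (hc : ∀ w, act c (List.replicate (M + 1) 0 ++ₛ w) = List.replicate (M + 1) 0 ++ₛ w) :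
    farCopy y M k * c = c * farCopy y M k := by
  refine act_injective ?_
  have : (act c).Disjoint (act (farCopy y M k)) := by
    intro s
    by_cases hs : ∃ w, s = List.replicate (M + 1) 0 ++ₛ w
    · obtain ⟨w, rfl⟩ := hs
      exact Or.inl (hc w)
    · exact Or.inr (act_farCopy_of_notMem hm hy M k fun w h => hs ⟨w, h⟩)
  exact this.commute.eq

theorem exists_pathIn_farCopy (hm : 0 < m) {D : ℕ} (hD0 : 0 < D)
    (hD : ∀ g : BrownThompson (m + 1) 𝒢,
      ExchangesPrefixes (act g) (2 * D * stdLength g) (D * stdLength g))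
    {y : Fin (m + 1) → BrownThompson (m + 1) 𝒢}
    (hy : ∀ i, act (y i) = onCone i (act (xGen (m + 1) 𝒢 0))) :
    ∃ c C P R : ℕ, 0 < c ∧ ∀ r L, 0 < r → ∀ a : BrownThompson (m + 1) 𝒢,
      c * r ≤ stdLength a → stdLength a ≤ L →
      PathIn (standardGenerators (m + 1) 𝒢) {x | r ≤ stdLength x} (C * L) a
        (farCopy (y 0) (P * L) (R * L)) := by
  have hX := closure_standardGenerators (n := m + 1) (by omega) 𝒢
  set X := standardGenerators (m + 1) 𝒢
  set x := xGen (m + 1) 𝒢 0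
  obtain ⟨e, he0, hex, he⟩ : ∃ e, 0 < e ∧ stdLength x ≤ e ∧ ∀ i, stdLength (y i) ≤ e := by
    refine ⟨1 + stdLength x + ∑ i, stdLength (y i), by omega, by omega, fun i => ?_⟩
    have := Finset.single_le_sum (f := fun i => stdLength (y i)) (fun _ _ => Nat.zero_le _)
      (Finset.mem_univ i)
    omega
  -- `R` forces length at least `(3 + e) * L` on `b` times anything trivial on its cone. `P` makes
  -- the far cone deep enough for `a` to exchange its prefix for a nonempty one. `B * L` bounds
  -- `|b|`, and `K` forces `|a h^(K * L)|` to be at least `(2 + B) * L`.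
  set R := D * (3 + e) with hR
  set P := 2 * D with hP
  set B := P * e + R * e + P * e with hB
  set K := D * (2 + B) with hK
  -- The factor `1 + D * e` pays for the possible initial approach of `a h^j` to the identity, the
  -- factor `1 + e` for the detour inside one copy of `h`.
  refine ⟨(1 + D * e) * (1 + e), (K * e + 1 + B) + (1 + K * e + 1), P, R, by positivity, ?_⟩
  intro r L hr a ha haL
  have hc1 : 1 ≤ (1 + D * e) * (1 + e) := by
    have := Nat.zero_le (D * e)
    nlinarith
  have hrL : r ≤ L := by nlinarith
  set b := farCopy (y 0) (P * L) (R * L) with hb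
  have hbB : stdLength b ≤ B * L := by
    refine (stdLength_farCopy_le hm _ _ _).trans ?_
    have h1 := Nat.mul_le_mul_left (P * L) hex
    have h2 := Nat.mul_le_mul_left (R * L) (he 0)
    calc _ ≤ P * L * e + R * L * e + P * L * e := by gcongr
      _ = B * L := by rw [hB]; ring
  -- the cone in which `a` is changed
  obtain ⟨v, hv, hav⟩ := hD a (List.replicate (P * L + 1) 0) (by
    rw [List.length_replicate, hP]
    have := Nat.mul_le_mul_left (2 * D) haL
    omega)
  obtain ⟨v₀, v, rfl⟩ : ∃ v₀ v', v = v₀ :: v' := by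
    cases v with
    | cons v₀ v => exact ⟨v₀, v, rfl⟩
    | nil =>
      rw [List.length_replicate, List.length_nil, hP] at hv
      have := Nat.mul_le_mul_left D haL
      nlinarith
  obtain ⟨i, hi⟩ : ∃ i, v₀ ≠ i := by
    have : Nontrivial (Fin (m + 1)) := Fin.nontrivial_iff_two_le.2 (by omega)
    exact (exists_ne v₀).imp fun _ h => h.symm
  obtain ⟨h, hhe, hfix, hgrow⟩ : ∃ h : BrownThompson (m + 1) 𝒢, stdLength h ≤ e ∧
      (∀ s : Stream' (Fin (m + 1)), s.head ≠ i → act h s = s) ∧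
      ∀ j, j ≤ D * stdLength (a * h ^ j) := by
    have hfix : ∀ s : Stream' (Fin (m + 1)), s.head ≠ i → act (y i) s = s := fun s hs => by
      rw [hy]; exact onCone_of_ne _ hs
    rcases growth hm hD (hy i) a with hg | hg
    · exact ⟨y i, he i, hfix, hg⟩
    · refine ⟨(y i)⁻¹, ?_, fun s hs => (act_inv_eq_iff _).2 (hfix s hs).symm, hg⟩
      rw [stdLength, wordLength_inv hX]
      exact he i
  have hconj : ∀ j w, act (a * h ^ j * a⁻¹) (List.replicate (P * L + 1) 0 ++ₛ w) =
      List.replicate (P * L + 1) 0 ++ₛ w := fun j w => by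
    rw [act_mul, act_mul, act_inv_eq_iff, hav]
    exact act_pow_of_head_ne hfix j hi
  have hinv : stdLength a⁻¹ = stdLength a := wordLength_inv hX a
  have hpow : ∀ j, stdLength (h ^ j) ≤ j * e := fun j =>
    (wordLength_pow_le hX h j).trans (Nat.mul_le_mul_left j hhe)
  have hbig : (2 + B) * L ≤ stdLength (a * h ^ (K * L)) := by
    refine Nat.le_of_mul_le_mul_left ?_ hD0
    rw [← mul_assoc, ← hK]
    exact hgrow _
  have hbc : ∀ j, (3 + e) * L ≤ stdLength (b * (a * h ^ j * a⁻¹)) := fun j => by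
    refine Nat.le_of_mul_le_mul_left ?_ hD0
    rw [← mul_assoc, ← hR]
    exact le_stdLength_farCopy_mul hm hD (hy 0) _ _ (hconj j)
  have heL : e ≤ e * L := Nat.le_mul_of_pos_right e (by omega)
  have hbc' : ∀ j, (2 + e) * L ≤ stdLength (b * a * h ^ j) := fun j => by
    have h1 := wordLength_mul_le hX (b * a * h ^ j) a⁻¹
    have h2 := hbc j
    simp only [← mul_assoc] at h2
    change _ ≤ _ + stdLength a⁻¹ at h1
    change _ ≤ stdLength (b * a * h ^ j) + _ at h1
    change stdLength _ ≤ _ at h1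
    have h3 : (3 + e) * L = (2 + e) * L + L := by ring
    omega
  have path₁ : PathIn X {x | r ≤ stdLength x} (K * L * e) a (a * h ^ (K * L)) := by
    have hra : r ≤ stdLength a := by nlinarith
    refine PathIn.pow (show a ∈ {x | r ≤ stdLength x} from hra) _ fun j _ => ?_
    refine (PathIn.of_add_le hX (r := r) (a * h ^ j) h ?_).mono le_rfl hhe
    change r + stdLength h ≤ stdLength (a * h ^ j)
    have h1 : stdLength a ≤ stdLength (a * h ^ j) + stdLength (h ^ j) :=
      wordLength_le_mul_add hX _ _
    have h2 : (1 + D * e) * ((1 + e) * r) ≤ (1 + D * e) * stdLength (a * h ^ j) := by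
      have h3 := Nat.mul_le_mul_right e (hgrow j)
      have h4 := hpow j
      calc _ = (1 + D * e) * (1 + e) * r := by ring
        _ ≤ stdLength (a * h ^ j) + D * stdLength (a * h ^ j) * e := by omega
        _ = _ := by ring
    have h3 := Nat.le_of_mul_le_mul_left h2 (by positivity)
    have h4 : e ≤ e * r := Nat.le_mul_of_pos_right e hr
    calc r + stdLength h ≤ r + e * r := by omega
      _ = (1 + e) * r := by ring
      _ ≤ _ := h3
  have path₂ : PathIn X {x | r ≤ stdLength x} L (a * h ^ (K * L)) (a * h ^ (K * L) * a⁻¹) := by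
    refine (PathIn.of_add_le hX (r := r) _ a⁻¹ ?_).mono le_rfl (hinv.le.trans haL)
    change r + stdLength a⁻¹ ≤ stdLength _
    have : (2 + B) * L = L + L + B * L := by ring
    omega
  have path₃ : PathIn X {x | r ≤ stdLength x} (B * L) (a * h ^ (K * L) * a⁻¹)
      (a * h ^ (K * L) * a⁻¹ * b) := by
    refine (PathIn.of_add_le hX (r := r) _ b ?_).mono le_rfl hbB
    change r + stdLength b ≤ stdLength _
    have h1 : stdLength (a * h ^ (K * L)) ≤ stdLength (a * h ^ (K * L) * a⁻¹) + stdLength a⁻¹ :=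
      wordLength_le_mul_add hX _ _
    have : (2 + B) * L = L + L + B * L := by ring
    omega
  have hL2 : (2 + e) * L = L + L + e * L := by ring
  have path₄ : PathIn X {x | r ≤ stdLength x} L b (b * a) := by
    refine (PathIn.of_add_le hX (r := r) b a ?_).mono le_rfl haL
    change r + stdLength a ≤ stdLength b
    have h1 := hbc 0
    rw [pow_zero, mul_one, mul_inv_cancel, mul_one] at h1
    have h3 : (3 + e) * L = (2 + e) * L + L := by ring
    omega
  have path₅ : PathIn X {x | r ≤ stdLength x} (K * L * e) (b * a) (b * a * h ^ (K * L)) := by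
    have hba : r ≤ stdLength (b * a) := by
      have := hbc' 0
      rw [pow_zero, mul_one] at this
      omega
    refine PathIn.pow (show b * a ∈ {x | r ≤ stdLength x} from hba) _ fun j _ => ?_
    refine (PathIn.of_add_le hX (r := r) (b * a * h ^ j) h ?_).mono le_rfl hhe
    have := hbc' j
    change r + stdLength h ≤ stdLength (b * a * h ^ j)
    omega
  have path₆ : PathIn X {x | r ≤ stdLength x} L (b * a * h ^ (K * L))
      (b * a * h ^ (K * L) * a⁻¹) := by
    refine (PathIn.of_add_le hX (r := r) _ a⁻¹ ?_).mono le_rfl (hinv.le.trans haL)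
    have := hbc' (K * L)
    change r + stdLength a⁻¹ ≤ stdLength _
    omega
  have hcomm : b * a * h ^ (K * L) * a⁻¹ = a * h ^ (K * L) * a⁻¹ * b := by
    rw [← farCopy_mul_comm hm (hy 0) _ _ (hconj (K * L))]
    simp only [mul_assoc, hb]
  rw [hcomm] at path₆
  refine (((path₁.trans path₂).trans path₃).trans ((path₄.trans path₅).trans path₆).symm).mono
    le_rfl (le_of_eq ?_)
  ring

/-! ## The target element -/

/-- Below `0^(q+1)` the element shortens one cone by a letter and lengthens another by a letter. So
it does not exchange the prefix `0^(q+1)` for a single word, which a shorter element would have to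
do. -/
theorem le_stdLength_of_eq_target (hm : 0 < m) {D : ℕ}
    (hD : ∀ g : BrownThompson (m + 1) 𝒢,
      ExchangesPrefixes (act g) (2 * D * stdLength g) (D * stdLength g)) (q : ℕ) :
    q + 2 ≤ 2 * D * stdLength (xGen (m + 1) 𝒢 0 ^ (q + 2) * (xGen (m + 1) 𝒢 (Fin.last m))⁻¹ *
      (xGen (m + 1) 𝒢 0 ^ (q + 1))⁻¹) := by
  set x := xGen (m + 1) 𝒢 0 with hx
  set z := x ^ (q + 2) * (xGen (m + 1) 𝒢 (Fin.last m))⁻¹ * (x ^ (q + 1))⁻¹ with hz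
  obtain ⟨hx1, hx2, hx3⟩ := act_xGen_zero (𝒢 := 𝒢) hm
  have hlast : (0 : Fin (m + 1)) ≠ Fin.last m := fun h => hm.ne (congrArg Fin.val h)
  have hz1 : ∀ w, act z (List.replicate (q + 3) 0 ++ₛ w) = List.replicate (q + 2) 0 ++ₛ w := by
    intro w
    rw [hz, act_mul, act_mul, act_inv_eq_iff, act_inv_eq_iff, act_xGen_zero_pow hm,
      act_xGen_zero_pow hm, act_xGen_last hm,
      onCone_of_ne (i := Fin.last m) (s := Stream'.cons 0 _) _ hlast]
  have hz2 : ∀ w, act z (List.replicate (q + 1) 0 ++ₛ Stream'.cons (Fin.last m) w) =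
      List.replicate (q + 1) 0 ++ₛ Stream'.cons (Fin.last m) (Stream'.cons (Fin.last m) w) := by
    intro w
    rw [hz, act_mul, act_mul, act_inv_eq_iff, act_inv_eq_iff, pow_succ x (q + 1), pow_succ x q,
      act_mul, act_mul, act_mul, act_xGen_zero_pow hm, act_xGen_zero_pow hm, hx2, hx2, hx3,
      act_xGen_last hm, onCone_cons, hx2]
  by_contra! hlt
  obtain ⟨v, -, hv⟩ := hD z (List.replicate (q + 1) 0) (by rw [List.length_replicate]; omega)
  have h1 : (v ++ List.replicate 2 0).length = (List.replicate (q + 2) (0 : Fin (m + 1))).length :=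
    length_eq_of_forall_append_stream (by omega) fun w => by
      rw [Stream'.append_append_stream, ← hv, ← hz1, show q + 3 = (q + 1) + 2 by omega,
        replicate_add_append 0 (q + 1) 2]
  have h2 : (v ++ [Fin.last m]).length =
      (List.replicate (q + 1) (0 : Fin (m + 1)) ++ [Fin.last m, Fin.last m]).length :=
    length_eq_of_forall_append_stream (by omega) fun w => by
      rw [Stream'.append_append_stream, ← hv, Stream'.append_append_stream]
      exact hz2 w
  simp only [List.length_append, List.length_replicate, List.length_cons, List.length_nil] at h1 h2
  omega

theorem numLeaves_one_le {n : ℕ} (hn : 0 < n) (𝒢 : ThompsonType) :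
    numLeaves (1 : BrownThompson n 𝒢) ≤ 1 := by
  refine Nat.sInf_le ⟨⟨.leaf, .leaf, [[]], .refl _, rfl⟩, ?_, ?_, rfl⟩
  · rintro ⟨u, v, h⟩
    have := congrArg Prod.fst (List.mem_singleton.1 (h ⟨0, hn⟩))
    simp at this
  · intro b hb w
    rw [List.mem_singleton.1 hb]
    rfl

end Path

/-! ### The path from `g` to the target -/

theorem proposition3p9 (n : ℕ) (hn : 2 ≤ n) (𝒢 : ThompsonType) :
    ∃ (δ D : ℝ) (Q : ℕ), 0 < δ ∧ 0 < D ∧ 0 < Q ∧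
      ∀ g : BrownThompson n 𝒢, 3 * n - 2 ≤ numLeaves g →
        ∃ ω : List (BrownThompson n 𝒢),
          IsWord (standardGenerators n 𝒢) ω ∧
          (ω.length : ℝ) ≤ D * (stdLength g : ℝ) ∧
          (∀ ω' : List (BrownThompson n 𝒢), ω' <+: ω →
            δ * (stdLength g : ℝ) < (stdLength (g * ω'.prod) : ℝ)) ∧
          g * ω.prod =
            xGen n 𝒢 ⟨0, by omega⟩ ^ ((Q : ℤ) * (stdLength g : ℤ)) *
              (xGen n 𝒢 ⟨n - 1, by omega⟩)⁻¹ *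
              xGen n 𝒢 ⟨0, by omega⟩ ^ (-((Q : ℤ) * (stdLength g : ℤ)) + 1) := by
  obtain ⟨m, rfl⟩ : ∃ m, n = m + 1 := ⟨n - 1, by omega⟩
  have hm : 0 < m := by omega
  have hX := closure_standardGenerators hn 𝒢
  obtain ⟨D, hD0, hD⟩ := exists_exchangesPrefixes_stdLength hn 𝒢
  choose y hy using exists_act_eq_onCone hm 𝒢
  obtain ⟨c, C, P, R, hc, hpath⟩ := exists_pathIn_farCopy hm hD0 hD hy
  set x := xGen (m + 1) 𝒢 0 with hx
  set t := xGen (m + 1) 𝒢 (Fin.last m) with ht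
  have hgen : ∀ i, xGen (m + 1) 𝒢 i ∈ standardGenerators (m + 1) 𝒢 := fun i => by
    cases 𝒢
    · exact ⟨i, rfl⟩
    · exact Or.inl ⟨i, rfl⟩
    · exact Or.inl ⟨i, rfl⟩
  set Q := 2 * D * c with hQ
  -- `A * l` bounds the lengths of both the pushed-out `g` and the target, so that both reach the
  -- same far copy.
  set A := 1 + D * c + (2 * Q + 1) with hA
  have hDc : 0 < D * c := by positivity
  refine ⟨1 / (2 + D), D * c + C * A + C * A, Q, by positivity, by positivity, by positivity,
    fun g hg => ?_⟩
  set l := stdLength g with hl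
  have hl0 : 0 < l := by
    rw [Nat.pos_iff_ne_zero]
    intro h0
    have := numLeaves_one_le m.succ_pos 𝒢
    rw [eq_one_of_wordLength_eq_zero hX h0] at hg
    omega
  -- a first path which leads away from the identity
  obtain ⟨h, hh, hgrow⟩ : ∃ h, (h ∈ standardGenerators (m + 1) 𝒢 ∨
      h⁻¹ ∈ standardGenerators (m + 1) 𝒢) ∧ ∀ j, j ≤ D * stdLength (g * h ^ j) := by
    rcases growth hm hD (act_xGen_last hm) g with h | h
    · exact ⟨t, Or.inl (hgen _), h⟩
    · exact ⟨t⁻¹, Or.inr (by rw [inv_inv]; exact hgen _), h⟩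
  have hpow : ∀ j, stdLength (h ^ j) ≤ j := fun j =>
    (wordLength_pow_le hX h j).trans ((Nat.mul_le_mul_left j (wordLength_le_one hh)).trans_eq
      (mul_one j))
  set S : Set (BrownThompson (m + 1) 𝒢) := {a | l ≤ (1 + D) * stdLength a} with hS
  -- Add `l ≤ |g h^j| + j` and `j ≤ D * |g h^j|`.
  have hgS : ∀ j, g * h ^ j ∈ S := fun j => by
    have h1 : l ≤ stdLength (g * h ^ j) + stdLength (h ^ j) := wordLength_le_mul_add hX _ _
    have h2 := hpow j
    have h3 := hgrow j
    change l ≤ _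
    rw [add_mul]
    omega
  have path₁ : PathIn (standardGenerators (m + 1) 𝒢) S (D * c * l * 1) g
      (g * h ^ (D * c * l)) := by
    refine PathIn.pow (by simpa using hgS 0) _ fun j _ => PathIn.step hh (hgS j) ?_
    rw [mul_assoc, ← pow_succ]
    exact hgS (j + 1)
  have hSub : {a : BrownThompson (m + 1) 𝒢 | l ≤ stdLength a} ⊆ S := fun a (ha : l ≤ _) => by
    change l ≤ _
    rw [add_mul]
    omega
  have path₂ : PathIn (standardGenerators (m + 1) 𝒢) S (C * (A * l)) (g * h ^ (D * c * l))
      (farCopy (y 0) (P * (A * l)) (R * (A * l))) := by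
    refine (hpath l (A * l) hl0 _ ?_ ?_).mono hSub le_rfl
    · refine Nat.le_of_mul_le_mul_left ?_ hD0
      rw [← mul_assoc]
      exact hgrow _
    · have h1 : stdLength (g * h ^ (D * c * l)) ≤ stdLength g + stdLength (h ^ (D * c * l)) :=
        wordLength_mul_le hX _ _
      have h2 := hpow (D * c * l)
      have h3 : A * l = l + D * c * l + (2 * Q + 1) * l := by rw [hA]; ring
      omega
  -- the path which leads to the target
  obtain ⟨q, hq⟩ : ∃ q, Q * l = q + 2 := by
    refine Nat.exists_eq_add_of_le' ?_
    have : Q * l = 2 * (D * c * l) := by rw [hQ]; ring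
    have : 0 < D * c * l := by positivity
    omega
  set z := x ^ (q + 2) * t⁻¹ * (x ^ (q + 1))⁻¹ with hz
  have path₃ : PathIn (standardGenerators (m + 1) 𝒢) S (C * (A * l)) z
      (farCopy (y 0) (P * (A * l)) (R * (A * l))) := by
    refine (hpath l (A * l) hl0 _ ?_ ?_).mono hSub le_rfl
    · have := le_stdLength_of_eq_target (𝒢 := 𝒢) hm hD q
      refine Nat.le_of_mul_le_mul_left ?_ (show 0 < 2 * D by omega)
      rw [← mul_assoc, ← hQ, hq]
      exact this
    · have h1 := wordLength_mul_le hX (x ^ (q + 2) * t⁻¹) (x ^ (q + 1))⁻¹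
      have h2 := wordLength_mul_le hX (x ^ (q + 2)) t⁻¹
      have hx1 : wordLength (standardGenerators (m + 1) 𝒢) x ≤ 1 :=
        wordLength_le_one (Or.inl (hgen 0))
      have ht1 : wordLength (standardGenerators (m + 1) 𝒢) t ≤ 1 :=
        wordLength_le_one (Or.inl (hgen _))
      have h3 := wordLength_pow_le hX x (q + 2)
      have h4 := wordLength_pow_le hX x (q + 1)
      have h5 := Nat.mul_le_mul_left (q + 2) hx1
      have h6 := Nat.mul_le_mul_left (q + 1) hx1
      rw [← hz, wordLength_inv hX] at h1
      rw [wordLength_inv hX] at h2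
      have h7 : A * l = (1 + D * c) * l + (Q * l + Q * l + l) := by rw [hA]; ring
      change wordLength _ z ≤ _
      rw [mul_one] at h5 h6
      rw [h7, hq]
      omega
  obtain ⟨ω, h1, h2, h3, h4⟩ := (path₁.trans path₂).trans path₃.symm
  refine ⟨ω, h1, ?_, fun ω' hω' => ?_, ?_⟩
  · calc (ω.length : ℝ) ≤ ((D * c * l * 1 + C * (A * l) + C * (A * l) : ℕ) : ℝ) := by
          exact_mod_cast h2
      _ = _ := by push_cast; ring
  · have h5 : l ≤ (1 + D) * stdLength (g * ω'.prod) := h4 ω' hω'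
    have h6 : 0 < stdLength (g * ω'.prod) := by
      rw [Nat.pos_iff_ne_zero]
      intro h0
      rw [h0] at h5
      omega
    rw [div_mul_eq_mul_div, one_mul, div_lt_iff₀ (by positivity)]
    have h7 : l < stdLength (g * ω'.prod) * (2 + D) := by nlinarith
    exact_mod_cast h7
  · rw [h3, hz]
    have h5 : (Q : ℤ) * (l : ℤ) = ((q + 2 : ℕ) : ℤ) := by rw [← hq]; push_cast; rfl
    have h6 : -((q + 2 : ℕ) : ℤ) + 1 = -((q + 1 : ℕ) : ℤ) := by push_cast; ring
    rw [h5, h6, zpow_natCast, zpow_neg, zpow_natCast]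
    rfl
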